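/- Work in $\mathbb R^3$ with Cartesian coordinates and the summation convention. A (homogeneous, linear, Toupin--Mindlin) strain-gradient material is a triple of constant tensors $(\mathsf C,\mathsf M,\mathsf A)$ of orders $4,5,6$ with $$\mathsf C_{ijlm}=\mathsf C_{jilm}=\mathsf C_{lmij},\qquad \mathsf M_{ijklm}=\mathsf M_{jiklm}=\mathsf M_{ijlkm},\qquad \mathsf A_{ijklmn}=\mathsf A_{jiklmn}=\mathsf A_{lmnijk}.$$ For a displacement field $u$ put $e_{lm}=\tfrac12(u_{l,m}+u_{m,l})$, $$\sigma_{ik}=\mathsf C_{iklm}e_{lm}+\mathsf M_{iklmn}e_{lm,n},\qquad \tau_{ijk}=\mathsf M_{lmijk}e_{lm}+\mathsf A_{ijklmn}e_{lm,n},$$ and let the $k$-th component of the internal force be $\sigma_{ik,i}-\tau_{ijk,ij}$; everything below is also asserted with the other index placement $\sigma_{ik,i}-\tau_{ikj,ij}$, which is the Euler--Lagrange expression of the energy $\tfrac12\,e\!:\!\mathsf C\!:\!e+e\!:\!\mathsf M\!:\!\nabla e+\tfrac12\nabla e\!:\!\mathsf A\!:\!\nabla e$. The symmetry group of a material is the set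 of all $Q\in O(3)$ that leave $\mathsf C$, $\mathsf M$ and $\mathsf A$ invariant; the class $SO(3)$ consists of the materials whose symmetry group is exactly $SO(3)$, and a material is called rotation-invariant if its symmetry group contains $SO(3)$. A displacement field $u$ on an open set $\Omega\subseteq\mathbb R^3$ is universal for a set of materials if the internal force vanishes on $\Omega$ for every material of that set; it is a classical isotropic universal displacement if $(\mathsf C_{iklm}e_{lm})_{,i}=0$ on $\Omega$ for every elasticity tensor $\mathsf C$ with symmetry group $O(3)$. For $r\in\{4,5,\dots\}\cup\{\infty\}$ and $U$ open, a Poisson potential field on $U$ is a field $w$ with $w_i=\partial_jW_{ij}$, where $W$ is an antisymmetric matrix of $C^r$ functions on $U$ that solve Poisson's equations $\Delta W_{ij}=S_{ij}$ with sources satisfying $\partial_jS_{ij}=0$. (With $W_{12}=\alpha$, $W_{13}=\beta$, $W_{23}=\gamma$ and $f=\Delta\alpha$, $g=\Delta\beta$, $h=\Delta\gamma$ the last condition reads $f_{,2}+g_{,3}=0$, $f_{,1}-h_{,3}=0$, $g_{,1}+h_{,2}=0$.) **(1)** The rotation-invariant coupling tensors $\mathsf M$ form a one-dimensional space. There is a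 linear isomorphism $\mathsf M\mapsto f(\mathsf M)$ of this space onto $\mathbb R$ such that for every rotation-invariant material there are constants $\lambda,\mu,a,b$ for which the internal force of every $C^4$ field $u$ on every open set is $$\mu\,\Delta u+(\lambda+\mu)\operatorname{grad}\operatorname{div}u-a\,\Delta\Delta u-b\,\Delta\operatorname{grad}\operatorname{div}u+2f(\mathsf M)\,\Delta\operatorname{curl}u .$$ **(2)** Let $\Omega\subseteq\mathbb R^3$ be open and $u\in C^r(\Omega;\mathbb R^3)$. The following are equivalent: (i) $u$ is universal for the class $SO(3)$; (ii) $u$ is universal for the rotation-invariant materials; (iii) $u$ is a classical isotropic universal displacement; (iv) $\Delta u=0$ and $\operatorname{grad}\operatorname{div}u=0$ on $\Omega$; (v) $\Delta u=0$, $\operatorname{grad}\operatorname{div}u=0$ and $\Delta\operatorname{curl}u=0$ on $\Omega$ (so the third constraint follows from the first two); (vi) on every star-shaped open $U\subseteq\Omega$ one has $u(x)=\tfrac c3x+k+w(x)$ with a constant $c\in\mathbb R$, a constant vector $k$ and a Poisson potential field $w$ on $U$; (vii) every point of $\Omega$ has an open neighbourhood $U\subseteq\Omega$ on which $u(x)=Fx+b+w(x)$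 with a constant matrix $F$, a constant vector $b$ and a Poisson potential field $w$ on $U$. **(3)** If $\Omega$ itself is star-shaped (for instance $\Omega=\mathbb R^3$ or $\Omega$ convex), then (i) and (iii) are equivalent to each of the two representations, $\tfrac c3x+k+w$ and $Fx+b+w$, on all of $\Omega$. -/

import Mathlib

open scoped InnerProductSpace Laplacian Gradient Matrix

noncomputable section

namespace StrainGradient

/-- Three-dimensional Euclidean space, with its Cartesian coordinates. -/
abbrev E3 := EuclideanSpace ℝ (Fin 3)

/-- The partial derivative `∂f/∂xᵢ` of a scalar function. -/
def pd (i : Fin 3) (f : E3 → ℝ) : E3 → ℝ :=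
  fun x => fderiv ℝ f x (EuclideanSpace.single i 1)

/-- The divergence of a vector field. -/
def divergence (u : E3 → E3) : E3 → ℝ :=
  fun x => ∑ i, pd i (fun y => u y i) x

/-- The curl of a vector field. -/
def curl (u : E3 → E3) : E3 → E3 :=
  fun x => !₂[pd 1 (fun y => u y 2) x - pd 2 (fun y => u y 1) x,
    pd 2 (fun y => u y 0) x - pd 0 (fun y => u y 2) x,
    pd 0 (fun y => u y 1) x - pd 1 (fun y => u y 0) x]

/-! ### Tensors of order four, five and six and the action of matrices on them -/

abbrev Tensor4 := Fin 3 → Fin 3 → Fin 3 → Fin 3 → ℝ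

abbrev Tensor5 := Fin 3 → Fin 3 → Fin 3 → Fin 3 → Fin 3 → ℝ

abbrev Tensor6 := Fin 3 → Fin 3 → Fin 3 → Fin 3 → Fin 3 → Fin 3 → ℝ

def rotate4 (Q : Matrix (Fin 3) (Fin 3) ℝ) (C : Tensor4) : Tensor4 :=
  fun i j k l => ∑ o, ∑ p, ∑ q, ∑ r, Q i o * Q j p * Q k q * Q l r * C o p q r

def rotate5 (Q : Matrix (Fin 3) (Fin 3) ℝ) (M : Tensor5) : Tensor5 :=
  fun i j k l m => ∑ o, ∑ p, ∑ q, ∑ r, ∑ s,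
    Q i o * Q j p * Q k q * Q l r * Q m s * M o p q r s

def rotate6 (Q : Matrix (Fin 3) (Fin 3) ℝ) (A : Tensor6) : Tensor6 :=
  fun i j k l m n => ∑ o, ∑ p, ∑ q, ∑ r, ∑ s, ∑ t,
    Q i o * Q j p * Q k q * Q l r * Q m s * Q n t * A o p q r s t

/-- Index symmetries of the classical elasticity tensor. -/
def HasSymmetriesC (C : Tensor4) : Prop :=
  (∀ i j l m, C i j l m = C j i l m) ∧ (∀ i j l m, C i j l m = C l m i j)

/-- Index symmetries of the fifth-order coupling tensor. -/
def HasSymmetriesM (M : Tensor5) : Prop :=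
  (∀ i j k l m, M i j k l m = M j i k l m) ∧ (∀ i j k l m, M i j k l m = M i j l k m)

/-- Index symmetries of the sixth-order strain-gradient tensor. -/
def HasSymmetriesA (A : Tensor6) : Prop :=
  (∀ i j k l m n, A i j k l m n = A j i k l m n) ∧
    (∀ i j k l m n, A i j k l m n = A l m n i j k)

/-- A homogeneous linear strain-gradient elastic material: a triple of constant elasticity tensors
with the index symmetries. No sign or definiteness condition is imposed. -/
structure Material where
  C : Tensor4
  M : Tensor5
  A : Tensor6
  symmC : HasSymmetriesC C
  symmM : HasSymmetriesM M
  symmA : HasSymmetriesA A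

/-! ### Symmetry groups -/

/-- The orthogonal group `O(3)`. -/
def O3 : Set (Matrix (Fin 3) (Fin 3) ℝ) := ↑(Matrix.orthogonalGroup (Fin 3) ℝ)

/-- The rotation group `SO(3)`. -/
def SO3 : Set (Matrix (Fin 3) (Fin 3) ℝ) := ↑(Matrix.specialOrthogonalGroup (Fin 3) ℝ)

def symmetryGroupC (C : Tensor4) : Set (Matrix (Fin 3) (Fin 3) ℝ) :=
  {Q | Q ∈ O3 ∧ rotate4 Q C = C}

def symmetryGroupM (M : Tensor5) : Set (Matrix (Fin 3) (Fin 3) ℝ) :=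
  {Q | Q ∈ O3 ∧ rotate5 Q M = M}

def symmetryGroupA (A : Tensor6) : Set (Matrix (Fin 3) (Fin 3) ℝ) :=
  {Q | Q ∈ O3 ∧ rotate6 Q A = A}

/-- The material symmetry group `G_A ∩ G_M ∩ G_C`. -/
def Material.symmetryGroup (m : Material) : Set (Matrix (Fin 3) (Fin 3) ℝ) :=
  symmetryGroupA m.A ∩ symmetryGroupM m.M ∩ symmetryGroupC m.C

/-- The symmetry class `SO(3)`: materials whose symmetry group is exactly `SO(3)`. -/
def classSO3 : Set Material := {m | m.symmetryGroup = SO3}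

/-- All materials that are invariant under every rotation, that is, all values of the elastic
constants of the class `SO(3)`, degenerate ones included. -/
def rotationInvariantMaterials : Set Material := {m | SO3 ⊆ m.symmetryGroup}

/-- The space of coupling tensors `M` with the index symmetries that are invariant under `SO(3)`. -/
def isotropicCouplingTensors : Submodule ℝ Tensor5 where
  carrier := {M | HasSymmetriesM M ∧ SO3 ⊆ symmetryGroupM M}
  zero_mem' := by
    refine ⟨⟨fun _ _ _ _ _ => rfl, fun _ _ _ _ _ => rfl⟩, fun Q hQ => ⟨?_, ?_⟩⟩
    · exact (Matrix.mem_specialOrthogonalGroup_iff.1 hQ).1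
    · funext i j k l m
      simp [rotate5]
  add_mem' := by
    rintro M N ⟨⟨hM₁, hM₂⟩, hM⟩ ⟨⟨hN₁, hN₂⟩, hN⟩
    refine ⟨⟨fun i j k l m => ?_, fun i j k l m => ?_⟩, fun Q hQ => ⟨(hM hQ).1, ?_⟩⟩
    · simp only [Pi.add_apply, hM₁ i j k l m, hN₁ i j k l m]
    · simp only [Pi.add_apply, hM₂ i j k l m, hN₂ i j k l m]
    · have h : rotate5 Q (M + N) = rotate5 Q M + rotate5 Q N := by
        funext i j k l m
        simp only [rotate5, Pi.add_apply, mul_add, Finset.sum_add_distrib]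
      rw [h, (hM hQ).2, (hN hQ).2]
  smul_mem' := by
    rintro c M ⟨⟨hM₁, hM₂⟩, hM⟩
    refine ⟨⟨fun i j k l m => ?_, fun i j k l m => ?_⟩, fun Q hQ => ⟨(hM hQ).1, ?_⟩⟩
    · simp only [Pi.smul_apply, hM₁ i j k l m]
    · simp only [Pi.smul_apply, hM₂ i j k l m]
    · have h : rotate5 Q (c • M) = c • rotate5 Q M := by
        funext i j k l m
        simp only [rotate5, Pi.smul_apply, smul_eq_mul, mul_left_comm _ c, Finset.mul_sum]
      rw [h, (hM hQ).2]

/-! ### Stresses and equilibrium -/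

/-- The linear strain `e_{lm} = (u_{l,m} + u_{m,l}) / 2`. -/
def strain (u : E3 → E3) (l m : Fin 3) : E3 → ℝ :=
  fun x => (pd m (fun y => u y l) x + pd l (fun y => u y m) x) / 2

/-- `σ_{ik} = C_{iklm} e_{lm} + M_{iklmn} e_{lm,n}`. -/
def stress (mat : Material) (u : E3 → E3) (i k : Fin 3) : E3 → ℝ :=
  fun x => (∑ l, ∑ m, mat.C i k l m * strain u l m x) +
    ∑ l, ∑ m, ∑ n, mat.M i k l m n * pd n (strain u l m) x

/-- `τ_{ijk} = M_{lmijk} e_{lm} + A_{ijklmn} e_{lm,n}`. -/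
def hyperstress (mat : Material) (u : E3 → E3) (i j k : Fin 3) : E3 → ℝ :=
  fun x => (∑ l, ∑ m, mat.M l m i j k * strain u l m x) +
    ∑ l, ∑ m, ∑ n, mat.A i j k l m n * pd n (strain u l m) x

/-- The two ways in which the double divergence of the hyperstress is contracted. In `τ_{ijk}` the
last index is the one that is conjugate to the derivative in `e_{ij,k}`. -/
inductive HyperstressContraction where
  /-- the free index of the double divergence is the last one: `τ_{ijk,ij}` -/
  | freeLast
  /-- one derivative is contracted with the last index, as in the Euler-Lagrange equation of the
  elastic energy: `τ_{ikj,ij}` -/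
  | freeMiddle

/-- The `k`-th component of the double divergence of the hyperstress. -/
def hyperstressDoubleDiv (conv : HyperstressContraction) (mat : Material) (u : E3 → E3)
    (k : Fin 3) : E3 → ℝ :=
  match conv with
  | .freeLast => fun x => ∑ i, ∑ j, pd i (pd j (hyperstress mat u i j k)) x
  | .freeMiddle => fun x => ∑ i, ∑ j, pd i (pd j (hyperstress mat u i k j)) x

/-- The left-hand side `σ_{ik,i} - τ_{ijk,ij}` of the balance of linear momentum. -/
def internalForce (conv : HyperstressContraction) (mat : Material) (u : E3 → E3) : E3 → E3 :=
  fun x => WithLp.toLp 2 fun k =>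
    (∑ i, pd i (stress mat u i k) x) - hyperstressDoubleDiv conv mat u k x

/-- `u` satisfies the equilibrium equations without body forces on `Ω` for every material of the
given class. -/
def IsUniversal (conv : HyperstressContraction) (cls : Set Material) (Ω : Set E3)
    (u : E3 → E3) : Prop :=
  ∀ mat ∈ cls, ∀ x ∈ Ω, internalForce conv mat u x = 0

/-- `u` is a universal displacement of classical linear isotropic elasticity: `σ_{ik,i} = 0` with
`σ_{ik} = C_{iklm} e_{lm}` for every elasticity tensor `C` with symmetry group `O(3)`. -/
def IsClassicalIsotropicUniversal (Ω : Set E3) (u : E3 → E3) : Prop :=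
  ∀ C : Tensor4, HasSymmetriesC C → symmetryGroupC C = O3 →
    ∀ x ∈ Ω, ∀ k, ∑ i, pd i (fun y => ∑ l, ∑ m, C i k l m * strain u l m y) x = 0

/-! ### Representation by potentials -/

/-- On `U`, `w` is the (row-wise) divergence of an antisymmetric matrix `W` of `C^r` functions that
solve Poisson's equations `Δ W_{ij} = S_{ij}`, where the matrix `S` of source terms is
divergence-free. -/
def IsDivOfPoissonPotential (r : ℕ∞) (U : Set E3) (w : E3 → E3) : Prop :=
  ∃ W S : Fin 3 → Fin 3 → E3 → ℝ,
    (∀ i j, ContDiffOn ℝ r (W i j) U) ∧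
    (∀ x ∈ U, ∀ i j, W i j x = -W j i x) ∧
    (∀ x ∈ U, ∀ i j, (Δ (W i j)) x = S i j x) ∧
    (∀ x ∈ U, ∀ i, ∑ j, pd j (S i j) x = 0) ∧
    (∀ x ∈ U, ∀ i, w x i = ∑ j, pd j (W i j) x)

/-- `u` is a homogeneous displacement field plus the divergence of an antisymmetric Poisson
potential. -/
def HasRepresentation (r : ℕ∞) (U : Set E3) (u : E3 → E3) : Prop :=
  ∃ (F : E3 →L[ℝ] E3) (b : E3) (w : E3 → E3),
    IsDivOfPoissonPotential r U w ∧ ∀ x ∈ U, u x = F x + b + w x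

/-- The same with a homogeneous part of the special form `(c / 3) x + k`. -/
def HasSpecialRepresentation (r : ℕ∞) (U : Set E3) (u : E3 → E3) : Prop :=
  ∃ (c : ℝ) (k : E3) (w : E3 → E3),
    IsDivOfPoissonPotential r U w ∧ ∀ x ∈ U, u x = (c / 3) • x + k + w x

end StrainGradient

end

open StrainGradient

open scoped InnerProductSpace Laplacian Gradient Matrix
open StrainGradient

namespace StrainGradient

section PartialDerivatives

/-! ### Partial derivatives -/

variable {Ω : Set E3} {f g : E3 → ℝ} {x : E3}

/-! The internal force is a constant-coefficient differential operator applied to `u`, with a part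
of order two coming from `C`, of order three from `M` and of order four from `A`. Since partial
derivatives commute, each part is determined by its polynomial symbol (`sum_pdList_eq_zero`), which
is a form B(ξ, a, b), bilinear in a and b. For a rotation-invariant material B is invariant too. As
rotations act transitively on the unit sphere, B is determined by its matrix at ξ = e₀, and a few
rotations preserving the axis of e₀ restrict this matrix: in even degree it is diagonal with the
last two entries equal, in degree three only an antisymmetric block remains (`symbol_even`,
`symbol_three`). Translated back, the only operators left are Δ and grad div, their Laplacians, and
Δ curl.

The coupling tensors are found by hand. Signed permutations reduce the components to three, one
further rotation gives two relations between them, and `chiralTensor` shows that the remaining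
component is free. The operator Δ curl enters with a nonzero multiple of that component, whichever
way the hyperstress is contracted.

An improper orthogonal matrix reverses the sign of `chiralTensor`. Hence the materials with this
coupling, Lamé constants λ, μ and `A` = 0 belong to the class `SO(3)` for all real λ, μ. Varying λ
and μ separates Δ curl u, Δu and grad div u, so all three vanish for a universal field. Conversely
Δu = 0 and grad div u = 0 annihilate every term of the force, Δ curl u = curl Δu included.

For the representation, grad div u = 0 makes div u a constant c on a star-shaped set, and u − (c/3)x
is divergence-free. The Poincaré lemma, with an explicit radial integral that keeps C^r regularity,
gives it an antisymmetric potential W. Putting S = ΔW, the divergence of S is the Laplacian of the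
field, which is zero. In the other direction, antisymmetry of W gives div w = 0, and div S = 0 gives
Δw = 0. -/

theorem pd_congr (hΩ : IsOpen Ω) (h : ∀ x ∈ Ω, f x = g x) (i : Fin 3) :
    ∀ x ∈ Ω, pd i f x = pd i g x := fun x hx => by
  have : f =ᶠ[nhds x] g := Filter.eventuallyEq_of_mem (hΩ.mem_nhds hx) h
  simp only [pd, this.fderiv_eq]

theorem contDiffOn_pd {m n : WithTop ℕ∞} (hΩ : IsOpen Ω) (hf : ContDiffOn ℝ n f Ω)
    (hmn : m + 1 ≤ n) (i : Fin 3) : ContDiffOn ℝ m (pd i f) Ω :=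
  (hf.fderiv_of_isOpen hΩ hmn).clm_apply contDiffOn_const

theorem pd_comm (hΩ : IsOpen Ω) (hf : ContDiffOn ℝ 2 f Ω) (i j : Fin 3) :
    ∀ x ∈ Ω, pd i (pd j f) x = pd j (pd i f) x := fun x hx => by
  have hs : IsSymmSndFDerivAt ℝ f x :=
    (hf.contDiffAt (hΩ.mem_nhds hx)).isSymmSndFDerivAt (by simp)
  have hd : DifferentiableAt ℝ (fderiv ℝ f) x :=
    ((hf.contDiffAt (hΩ.mem_nhds hx)).fderiv_right (m := 1) (by norm_num)).differentiableAt
      (by norm_num)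
  have key (a b : Fin 3) : pd a (pd b f) x =
      fderiv ℝ (fderiv ℝ f) x (EuclideanSpace.single a 1) (EuclideanSpace.single b 1) := by
    have : HasFDerivAt (fun y => fderiv ℝ f y (EuclideanSpace.single b (1:ℝ)))
        ((fderiv ℝ (fderiv ℝ f) x).flip (EuclideanSpace.single b 1)) x := by
      simpa using hd.hasFDerivAt.clm_apply (hasFDerivAt_const (EuclideanSpace.single b (1:ℝ)) x)
    simp only [pd]
    exact congrArg (fun T => T (EuclideanSpace.single a (1:ℝ))) this.fderiv
  rw [key, key, hs.eq]

theorem pd_sum_mul {ι : Type*} [Fintype ι] (c : ι → ℝ) {F : ι → E3 → ℝ}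
    (hF : ∀ a, DifferentiableAt ℝ (F a) x) (i : Fin 3) :
    pd i (fun y => ∑ a, c a * F a y) x = ∑ a, c a * pd i (F a) x := by
  have := HasFDerivAt.fun_sum (u := Finset.univ) fun a _ => (hF a).hasFDerivAt.const_mul (c a)
  simp only [pd, this.fderiv]
  simp

theorem pd_add (hf : DifferentiableAt ℝ f x) (hg : DifferentiableAt ℝ g x) (i : Fin 3) :
    pd i (fun y => f y + g y) x = pd i f x + pd i g x := by
  simp only [pd, fderiv_fun_add hf hg, add_apply]

theorem pd_sub (hf : DifferentiableAt ℝ f x) (hg : DifferentiableAt ℝ g x) (i : Fin 3) :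
    pd i (fun y => f y - g y) x = pd i f x - pd i g x := by
  simp only [pd, fderiv_fun_sub hf hg, sub_apply]

theorem pd_const (c : ℝ) (i : Fin 3) : pd i (fun _ => c) x = 0 := by simp [pd]

theorem pd_sum {ι : Type*} [Fintype ι] {F : ι → E3 → ℝ}
    (hF : ∀ a, DifferentiableAt ℝ (F a) x) (i : Fin 3) :
    pd i (fun y => ∑ a, F a y) x = ∑ a, pd i (F a) x := by
  simpa using pd_sum_mul (fun _ => 1) hF i

/-- Iterated partial derivatives. -/
noncomputable def pdList (l : List (Fin 3)) (f : E3 → ℝ) : E3 → ℝ := l.foldr pd f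

theorem contDiffOn_pdList (hΩ : IsOpen Ω) (l : List (Fin 3)) {n : ℕ}
    (hf : ContDiffOn ℝ (n + l.length : ℕ) f Ω) : ContDiffOn ℝ n (pdList l f) Ω := by
  induction l generalizing n with
  | nil => simpa [pdList] using hf
  | cons a l ih =>
    refine contDiffOn_pd (n := (n + 1 : ℕ)) hΩ (ih ?_) (by push_cast; rfl) a
    rwa [show n + 1 + l.length = n + (a :: l).length by rw [List.length_cons]; omega]

/-- Permutations are generated by adjacent swaps, and each swap is Schwarz's theorem applied to the
derivative taken before it. -/
theorem pdList_perm (hΩ : IsOpen Ω) {l₁ l₂ : List (Fin 3)} (h : l₁.Perm l₂)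
    (hf : ContDiffOn ℝ l₁.length f Ω) : ∀ x ∈ Ω, pdList l₁ f x = pdList l₂ f x := by
  induction h with
  | nil => intros; rfl
  | cons a _ ih => exact pd_congr hΩ (ih (hf.of_le (by simp))) a
  | swap a b l =>
    refine pd_comm hΩ (contDiffOn_pdList (n := 2) hΩ l (hf.of_le ?_)) b a
    simp only [List.length_cons]; norm_cast; omega
  | trans h₁ h₂ ih₁ ih₂ =>
    intro x hx
    rw [ih₁ hf x hx, ih₂ (by rwa [← h₁.length_eq]) x hx]

/-- The functional on polynomials that sends a monomial `∂₀^a ∂₁^b ∂₂^c` to the corresponding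
partial derivative of `f` at `x`. -/
noncomputable def symbolFunctional (f : E3 → ℝ) (x : E3) : MvPolynomial (Fin 3) ℝ →ₗ[ℝ] ℝ :=
  (MvPolynomial.basisMonomials (Fin 3) ℝ).constr ℝ fun s => pdList s.toMultiset.toList f x

/-- The functional orders the indices of a monomial by the arbitrary choice in `Multiset.toList`;
commutation of derivatives makes that choice irrelevant. -/
theorem symbolFunctional_prod_X (hΩ : IsOpen Ω) (l : List (Fin 3))
    (hf : ContDiffOn ℝ l.length f Ω) (hx : x ∈ Ω) :
    symbolFunctional f x (l.map MvPolynomial.X).prod = pdList l f x := by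
  have h : (l.map MvPolynomial.X).prod =
      MvPolynomial.basisMonomials (Fin 3) ℝ (Multiset.toFinsupp (l : Multiset (Fin 3))) := by
    rw [MvPolynomial.coe_basisMonomials]
    clear hf
    induction l with
    | nil => simp
    | cons a l ih =>
      rw [List.map_cons, List.prod_cons, ih, ← Multiset.cons_coe, ← Multiset.singleton_add, map_add,
        Multiset.toFinsupp_singleton, MvPolynomial.X, MvPolynomial.monomial_mul, mul_one]
  rw [h, symbolFunctional, Module.Basis.constr_basis, Multiset.toFinsupp_toMultiset]
  refine (pdList_perm hΩ (Multiset.coe_eq_coe.1 (Multiset.coe_toList _).symm) hf x hx).symm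

/-- A constant-coefficient linear combination of partial derivatives vanishes if its symbol does. -/
theorem sum_pdList_eq_zero {ι : Type*} [Fintype ι] (hΩ : IsOpen Ω) (l : ι → List (Fin 3))
    (c : ι → ℝ) (hc : ∀ ξ : Fin 3 → ℝ, ∑ a, c a * ((l a).map ξ).prod = 0)
    (hf : ∀ a, ContDiffOn ℝ (l a).length f Ω) (hx : x ∈ Ω) :
    ∑ a, c a * pdList (l a) f x = 0 := by
  have h : ∑ a, c a • ((l a).map (MvPolynomial.X (R := ℝ))).prod = 0 := by
    -- Over an infinite field a polynomial with only zero values is the zero polynomial, so real ξ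
    -- suffice.
    refine MvPolynomial.funext fun ξ => ?_
    rw [map_sum, map_zero, ← hc ξ]
    refine Finset.sum_congr rfl fun a _ => ?_
    rw [MvPolynomial.smul_eval, map_list_prod, List.map_map]
    congr 3
    funext i
    simp
  have := congrArg (symbolFunctional f x) h
  rw [map_sum, map_zero] at this
  rw [← this]
  refine Finset.sum_congr rfl fun a _ => ?_
  rw [map_smul, symbolFunctional_prod_X hΩ (l a) (hf a) hx, smul_eq_mul]

/-! ### Laplacian, gradient and curl in coordinates -/

theorem laplacian_apply {f : E3 → ℝ} (hf : ContDiffAt ℝ 2 f x) :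
    (Δ f) x = ∑ i, pd i (pd i f) x := by
  have hd : DifferentiableAt ℝ (fderiv ℝ f) x :=
    (hf.fderiv_right (m := 1) (by norm_num)).differentiableAt (by norm_num)
  rw [InnerProductSpace.laplacian_eq_iteratedFDeriv_orthonormalBasis f
    (EuclideanSpace.basisFun (Fin 3) ℝ)]
  refine Finset.sum_congr rfl fun i _ => ?_
  rw [iteratedFDeriv_two_apply]
  have : HasFDerivAt (fun y => fderiv ℝ f y (EuclideanSpace.single i (1:ℝ)))
      ((fderiv ℝ (fderiv ℝ f) x).flip (EuclideanSpace.single i 1)) x := by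
    simpa using hd.hasFDerivAt.clm_apply (hasFDerivAt_const (EuclideanSpace.single i (1:ℝ)) x)
  simp only [pd]
  refine Eq.trans ?_ (congrArg (fun T => T (EuclideanSpace.single i (1:ℝ))) this.fderiv).symm
  simp

theorem laplacian_apply_apply {u : E3 → E3} (hu : ContDiffAt ℝ 2 u x) (k : Fin 3) :
    (Δ u) x k = (Δ fun y => u y k) x :=
  (hu.laplacian_CLM_comp_left (l := EuclideanSpace.proj k)).symm

theorem gradient_apply (f : E3 → ℝ) (x : E3) (k : Fin 3) : (∇ f x) k = pd k f x := by
  have h : inner ℝ (∇ f x) (EuclideanSpace.single k (1:ℝ)) = pd k f x := by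
    rw [gradient, InnerProductSpace.toDual_symm_apply, pd]
  rw [← h, EuclideanSpace.inner_single_right]
  simp

theorem contDiffOn_apply {n : WithTop ℕ∞} {u : E3 → E3} (hu : ContDiffOn ℝ n u Ω) (k : Fin 3) :
    ContDiffOn ℝ n (fun y => u y k) Ω :=
  (contDiffOn_euclidean.1 hu) k

end PartialDerivatives

section Rotations

/-! ### Rotations -/

theorem mem_SO3_iff {Q : Matrix (Fin 3) (Fin 3) ℝ} : Q ∈ SO3 ↔ Q ∈ O3 ∧ Q.det = 1 :=
  Matrix.mem_specialOrthogonalGroup_iff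

theorem mem_O3_iff {Q : Matrix (Fin 3) (Fin 3) ℝ} : Q ∈ O3 ↔ Q * Qᵀ = 1 :=
  Matrix.mem_orthogonalGroup_iff (A := Q)

theorem SO3_subset_O3 : SO3 ⊆ O3 := fun _ h => (mem_SO3_iff.1 h).1

theorem transpose_mul_self_of_mem_O3 {Q : Matrix (Fin 3) (Fin 3) ℝ} (hQ : Q ∈ O3) : Qᵀ * Q = 1 :=
  mul_eq_one_comm.1 (mem_O3_iff.1 hQ)

theorem transpose_mulVec_mulVec {Q : Matrix (Fin 3) (Fin 3) ℝ} (hQ : Q ∈ O3) (v : Fin 3 → ℝ) :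
    Qᵀ *ᵥ (Q *ᵥ v) = v := by
  rw [Matrix.mulVec_mulVec, transpose_mul_self_of_mem_O3 hQ, Matrix.one_mulVec]

theorem mulVec_transpose_mulVec {Q : Matrix (Fin 3) (Fin 3) ℝ} (hQ : Q ∈ O3) (v : Fin 3 → ℝ) :
    Q *ᵥ (Qᵀ *ᵥ v) = v := by
  rw [Matrix.mulVec_mulVec, mem_O3_iff.1 hQ, Matrix.one_mulVec]

/-- The matrix whose rows are the vectors `s i • e (σ i)`. -/
def signedPerm (σ : Fin 3 → Fin 3) (s : Fin 3 → ℝ) : Matrix (Fin 3) (Fin 3) ℝ :=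
  fun i j => if j = σ i then s i else 0

theorem signedPerm_mulVec (σ : Fin 3 → Fin 3) (s : Fin 3 → ℝ) (v : Fin 3 → ℝ) (i : Fin 3) :
    (signedPerm σ s *ᵥ v) i = s i * v (σ i) := by
  simp [signedPerm, Matrix.mulVec, dotProduct]

theorem signedPerm_mem_SO3 {σ : Fin 3 → Fin 3} {s : Fin 3 → ℝ} (hσ : Function.Injective σ)
    (hs : ∀ i, s i * s i = 1) (hdet : (signedPerm σ s).det = 1) : signedPerm σ s ∈ SO3 := by
  refine mem_SO3_iff.2 ⟨mem_O3_iff.2 ?_, hdet⟩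
  ext i j
  simp only [Matrix.mul_apply, Matrix.transpose_apply, signedPerm, Matrix.one_apply, ite_mul,
    zero_mul, Finset.sum_ite_eq', Finset.mem_univ, if_true, hσ.eq_iff]
  split_ifs with h
  · rw [h, hs]
  · rw [mul_zero]

theorem diag0_mem_SO3 : signedPerm id ![1, -1, -1] ∈ SO3 :=
  signedPerm_mem_SO3 Function.injective_id (by intro i; fin_cases i <;> simp)
    (by simp [Matrix.det_fin_three, signedPerm])

theorem diag1_mem_SO3 : signedPerm id ![-1, 1, -1] ∈ SO3 :=
  signedPerm_mem_SO3 Function.injective_id (by intro i; fin_cases i <;> simp)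
    (by simp [Matrix.det_fin_three, signedPerm])

theorem cyclic_mem_SO3 : signedPerm (· + 1) 1 ∈ SO3 :=
  signedPerm_mem_SO3 (add_left_injective 1) (by simp) (by simp [Matrix.det_fin_three, signedPerm])

theorem quarter0_mem_SO3 : signedPerm ![0, 2, 1] ![1, 1, -1] ∈ SO3 :=
  signedPerm_mem_SO3 (by decide) (by intro i; fin_cases i <;> simp)
    (by simp [Matrix.det_fin_three, signedPerm])

theorem quarter2_mem_SO3 : signedPerm ![1, 0, 2] ![1, -1, 1] ∈ SO3 :=
  signedPerm_mem_SO3 (by decide) (by intro i; fin_cases i <;> simp)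
    (by simp [Matrix.det_fin_three, signedPerm])

/-- The rotation by the angle `π` about the axis of the unit vector `n`. -/
def halfTurn (n : Fin 3 → ℝ) : Matrix (Fin 3) (Fin 3) ℝ :=
  fun i j => 2 * n i * n j - if i = j then 1 else 0

theorem halfTurn_mem_SO3 {n : Fin 3 → ℝ} (hn : n ⬝ᵥ n = 1) : halfTurn n ∈ SO3 := by
  simp only [dotProduct, Fin.sum_univ_three] at hn
  refine mem_SO3_iff.2 ⟨mem_O3_iff.2 ?_, ?_⟩
  · ext i j
    have : (halfTurn n * (halfTurn n)ᵀ) i j = (1 : Matrix (Fin 3) (Fin 3) ℝ) i j +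
        4 * n i * n j * (n 0 * n 0 + n 1 * n 1 + n 2 * n 2 - 1) := by
      fin_cases i <;> fin_cases j <;>
        simp [Matrix.mul_apply, Fin.sum_univ_three, halfTurn] <;> ring
    rw [this, hn, sub_self, mul_zero, add_zero]
  · have : (halfTurn n).det = 1 + 2 * (n 0 * n 0 + n 1 * n 1 + n 2 * n 2 - 1) := by
      simp [Matrix.det_fin_three, halfTurn]; ring
    rw [this, hn, sub_self, mul_zero, add_zero]

/-- The half turn about the bisector of e₀ and ξ exchanges the two vectors. The bisector degenerates
only for ξ = −e₀, where a diagonal rotation is used. -/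
theorem exists_rotation_mulVec_eq {ξ : Fin 3 → ℝ} (hξ : ξ ⬝ᵥ ξ = 1) :
    ∃ Q ∈ SO3, Q *ᵥ Pi.single 0 1 = ξ := by
  have hξ' := hξ
  simp only [dotProduct, Fin.sum_univ_three] at hξ'
  by_cases h : ξ 0 = -1
  · refine ⟨_, diag1_mem_SO3, ?_⟩
    have h1 : ξ 1 = 0 := by nlinarith
    have h2 : ξ 2 = 0 := by nlinarith
    funext i
    rw [signedPerm_mulVec]
    fin_cases i <;> simp [h, h1, h2]
  · have hpos : 0 < 1 + ξ 0 := by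
      have : -1 ≤ ξ 0 := by nlinarith [sq_nonneg (ξ 1), sq_nonneg (ξ 2)]
      have := lt_of_le_of_ne this (Ne.symm h)
      linarith
    -- This normalises the bisector: |e₀ + ξ|² = 2(1 + ξ₀).
    set c := (Real.sqrt (2 * (1 + ξ 0)))⁻¹ with hc
    have hc2 : c * c * (2 * (1 + ξ 0)) = 1 := by
      have := Real.mul_self_sqrt (show 0 ≤ 2 * (1 + ξ 0) by positivity)
      rw [hc, ← mul_inv, this, inv_mul_cancel₀ (by positivity)]
    have e0 : (c • (Pi.single 0 1 + ξ) : Fin 3 → ℝ) 0 = c * (1 + ξ 0) := by simp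
    refine ⟨halfTurn (c • (Pi.single 0 1 + ξ)), halfTurn_mem_SO3 ?_, ?_⟩
    · simp [dotProduct, Fin.sum_univ_three]
      linear_combination hc2 + c * c * hξ'
    · funext i
      simp only [Matrix.mulVec_single_one, Matrix.col_apply, halfTurn, e0]
      fin_cases i <;> simp
      · linear_combination (1 + ξ 0) * hc2
      · linear_combination ξ 1 * hc2
      · linear_combination ξ 2 * hc2

/-! ### Rotation-invariant symbols -/

section Symbol

variable {B : (Fin 3 → ℝ) → (Fin 3 → ℝ) → (Fin 3 → ℝ) → ℝ} {T : Matrix (Fin 3) (Fin 3) ℝ} {n : ℕ}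

theorem dotProduct_mulVec_mulVec {Q : Matrix (Fin 3) (Fin 3) ℝ} (hQ : Q ∈ O3) (a b : Fin 3 → ℝ) :
    (Qᵀ *ᵥ a) ⬝ᵥ (Qᵀ *ᵥ b) = a ⬝ᵥ b := by
  rw [Matrix.dotProduct_mulVec, Matrix.vecMul_transpose, mulVec_transpose_mulVec hQ]

theorem det_mulVec_mulVec {Q : Matrix (Fin 3) (Fin 3) ℝ} (hQ : Q ∈ SO3) (a b c : Fin 3 → ℝ) :
    (Matrix.of ![Qᵀ *ᵥ a, Qᵀ *ᵥ b, Qᵀ *ᵥ c]).det = (Matrix.of ![a, b, c]).det := by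
  have : Matrix.of ![Qᵀ *ᵥ a, Qᵀ *ᵥ b, Qᵀ *ᵥ c] = Matrix.of ![a, b, c] * Q := by
    ext i j
    fin_cases i <;> simp [Matrix.mul_apply, Matrix.mulVec, dotProduct, mul_comm]
  rw [this, Matrix.det_mul, (mem_SO3_iff.1 hQ).2, mul_one]

/-- Both forms are homogeneous of the same degree in ξ, so they are compared on the unit sphere; at
ξ = 0 both vanish because the degree is positive. -/
theorem symbol_of_dotProduct_self (hn : n ≠ 0)
    (hhom : ∀ (c : ℝ) ξ a b, B (c • ξ) a b = c ^ n * B ξ a b)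
    {G : (Fin 3 → ℝ) → (Fin 3 → ℝ) → (Fin 3 → ℝ) → ℝ}
    (hGhom : ∀ (c : ℝ) ξ a b, G (c • ξ) a b = c ^ n * G ξ a b)
    (h : ∀ ξ, ξ ⬝ᵥ ξ = 1 → ∀ a b, B ξ a b = G ξ a b) (ξ a b : Fin 3 → ℝ) : B ξ a b = G ξ a b := by
  rcases eq_or_ne ξ 0 with rfl | hξ
  · rw [← zero_smul ℝ (0 : Fin 3 → ℝ), hhom, hGhom, zero_pow hn, zero_mul, zero_mul]
  · have hpos : 0 < ξ ⬝ᵥ ξ :=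
      lt_of_le_of_ne (Finset.sum_nonneg fun i _ => mul_self_nonneg (ξ i))
        (Ne.symm (by simpa using hξ))
    have hs := Real.mul_self_sqrt hpos.le
    have hs0 : Real.sqrt (ξ ⬝ᵥ ξ) ≠ 0 := (Real.sqrt_pos.2 hpos).ne'
    have hu : ξ = Real.sqrt (ξ ⬝ᵥ ξ) • ((Real.sqrt (ξ ⬝ᵥ ξ))⁻¹ • ξ) := by
      rw [smul_smul, mul_inv_cancel₀ hs0, one_smul]
    rw [hu, hhom, hGhom, h]
    rw [smul_dotProduct, dotProduct_smul, smul_eq_mul, smul_eq_mul, ← mul_assoc, ← mul_inv, hs,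
      inv_mul_cancel₀ hpos.ne']

theorem single_apply_eq_ite (i j : Fin 3) :
    (Pi.single i 1 : Fin 3 → ℝ) j = if j = i then 1 else 0 := Pi.single_apply i 1 j

theorem symbol_single (h0 : ∀ a b, B (Pi.single 0 1) a b = ∑ k, ∑ l, T k l * (a k * b l))
    (k l : Fin 3) : B (Pi.single 0 1) (Pi.single k 1) (Pi.single l 1) = T k l := by
  simp [h0, Pi.single_apply]

/-- A signed permutation with σ 0 = 0 sends e₀ to ±e₀, so invariance becomes a relation within the
single matrix `T`. The factor `s 0 ^ n` is where the parity of the degree enters. -/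
theorem symbol_signedPerm
    (hB : ∀ Q ∈ SO3, ∀ ξ a b, B (Q *ᵥ ξ) (Q *ᵥ a) (Q *ᵥ b) = B ξ a b)
    (hhom : ∀ (c : ℝ) ξ a b, B (c • ξ) a b = c ^ n * B ξ a b)
    (h0 : ∀ a b, B (Pi.single 0 1) a b = ∑ k, ∑ l, T k l * (a k * b l))
    {σ : Fin 3 → Fin 3} {s : Fin 3 → ℝ} (hσ0 : σ 0 = 0) (hσ : Function.Injective σ)
    (hQ : signedPerm σ s ∈ SO3) (k l : Fin 3) :
    T (σ k) (σ l) = s 0 ^ n * (s k * s l) * T k l := by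
  have hv (i : Fin 3) : signedPerm σ s *ᵥ Pi.single (σ i) 1 = s i • Pi.single i 1 := by
    funext j
    rw [signedPerm_mulVec]
    simp only [single_apply_eq_ite, hσ.eq_iff, Pi.smul_apply, smul_eq_mul]
    split_ifs with h
    · rw [h]
    · simp
  have h := hB _ hQ (Pi.single (σ 0) 1) (Pi.single (σ k) 1) (Pi.single (σ l) 1)
  rw [hv, hv, hv, hhom, hσ0, h0, symbol_single h0] at h
  rw [← h]
  simp [Pi.single_apply]
  ring

/-- A rotation-invariant symbol of even degree. -/
theorem symbol_even {m : ℕ} (hm : n = 2 * (m + 1))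
    (hB : ∀ Q ∈ SO3, ∀ ξ a b, B (Q *ᵥ ξ) (Q *ᵥ a) (Q *ᵥ b) = B ξ a b)
    (hhom : ∀ (c : ℝ) ξ a b, B (c • ξ) a b = c ^ n * B ξ a b)
    (h0 : ∀ a b, B (Pi.single 0 1) a b = ∑ k, ∑ l, T k l * (a k * b l)) (ξ a b : Fin 3 → ℝ) :
    B ξ a b = T 1 1 * ((ξ ⬝ᵥ ξ) ^ (m + 1) * (a ⬝ᵥ b)) +
      (T 0 0 - T 1 1) * ((ξ ⬝ᵥ ξ) ^ m * ((ξ ⬝ᵥ a) * (ξ ⬝ᵥ b))) := by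
  refine symbol_of_dotProduct_self (n := n) (by omega) hhom
    (G := fun ξ a b => T 1 1 * ((ξ ⬝ᵥ ξ) ^ (m + 1) * (a ⬝ᵥ b)) +
      (T 0 0 - T 1 1) * ((ξ ⬝ᵥ ξ) ^ m * ((ξ ⬝ᵥ a) * (ξ ⬝ᵥ b)))) ?_ ?_ ξ a b
  · intro c ξ a b
    simp only [smul_dotProduct, dotProduct_smul, smul_eq_mul, hm, pow_mul, pow_succ, mul_pow]
    ring
  · intro ξ hξ a b
    obtain ⟨Q, hQ, rfl⟩ := exists_rotation_mulVec_eq hξ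
    have hQ' := SO3_subset_O3 hQ
    have key := hB Q hQ (Pi.single 0 1) (Qᵀ *ᵥ a) (Qᵀ *ᵥ b)
    rw [mulVec_transpose_mulVec hQ', mulVec_transpose_mulVec hQ', h0] at key
    have hd (v : Fin 3 → ℝ) : (Q *ᵥ Pi.single 0 1) ⬝ᵥ v = (Qᵀ *ᵥ v) 0 := by
      rw [Matrix.mulVec_single_one]
      simp [Matrix.mulVec, dotProduct]
    have hs0 : (![1, -1, -1] : Fin 3 → ℝ) 0 ^ n = 1 := by simp
    have hs1 : (![-1, 1, -1] : Fin 3 → ℝ) 0 ^ n = 1 := by simp [hm]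
    -- The two diagonal rotations kill the off-diagonal entries of `T`; the quarter turn about e₀
    -- equates its last two diagonal entries.
    have d0 := symbol_signedPerm hB hhom h0 rfl Function.injective_id diag0_mem_SO3
    have d1 := symbol_signedPerm hB hhom h0 rfl Function.injective_id diag1_mem_SO3
    have r0 := symbol_signedPerm hB hhom h0 rfl (by decide) quarter0_mem_SO3
    rw [hs0] at d0
    rw [hs1] at d1
    have t01 : T 0 1 = 0 := by have := d0 0 1; simp at this; linarith
    have t02 : T 0 2 = 0 := by have := d0 0 2; simp at this; linarith
    have t10 : T 1 0 = 0 := by have := d0 1 0; simp at this; linarith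
    have t20 : T 2 0 = 0 := by have := d0 2 0; simp at this; linarith
    have t12 : T 1 2 = 0 := by have := d1 1 2; simp at this; linarith
    have t21 : T 2 1 = 0 := by have := d1 2 1; simp at this; linarith
    have t22 : T 2 2 = T 1 1 := by have := r0 1 1; simpa using this
    rw [key, hξ, hd, hd, ← dotProduct_mulVec_mulVec hQ']
    simp only [dotProduct, Fin.sum_univ_three, t01, t02, t10, t20, t12, t21, t22]
    ring

/-- A rotation-invariant symbol of degree three. -/
theorem symbol_three
    (hB : ∀ Q ∈ SO3, ∀ ξ a b, B (Q *ᵥ ξ) (Q *ᵥ a) (Q *ᵥ b) = B ξ a b)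
    (hhom : ∀ (c : ℝ) ξ a b, B (c • ξ) a b = c ^ 3 * B ξ a b)
    (h0 : ∀ a b, B (Pi.single 0 1) a b = ∑ k, ∑ l, T k l * (a k * b l)) (ξ a b : Fin 3 → ℝ) :
    B ξ a b = T 1 2 * ((ξ ⬝ᵥ ξ) * (Matrix.of ![ξ, a, b]).det) := by
  refine symbol_of_dotProduct_self (n := 3) (by omega) hhom
    (G := fun ξ a b => T 1 2 * ((ξ ⬝ᵥ ξ) * (Matrix.of ![ξ, a, b]).det)) ?_ ?_ ξ a b
  · intro c ξ a b
    simp only [smul_dotProduct, dotProduct_smul, smul_eq_mul, Matrix.det_fin_three]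
    simp
    ring
  · intro ξ hξ a b
    obtain ⟨Q, hQ, rfl⟩ := exists_rotation_mulVec_eq hξ
    have hQ' := SO3_subset_O3 hQ
    have key := hB Q hQ (Pi.single 0 1) (Qᵀ *ᵥ a) (Qᵀ *ᵥ b)
    rw [mulVec_transpose_mulVec hQ', mulVec_transpose_mulVec hQ', h0] at key
    -- In odd degree the rotation reversing e₀ contributes a minus sign: it now kills the diagonal
    -- and spares `T 1 2`, and the quarter turn makes that block antisymmetric.
    have d0 := symbol_signedPerm hB hhom h0 rfl Function.injective_id diag0_mem_SO3
    have d1 := symbol_signedPerm hB hhom h0 rfl Function.injective_id diag1_mem_SO3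
    have r0 := symbol_signedPerm hB hhom h0 rfl (by decide) quarter0_mem_SO3
    have t01 : T 0 1 = 0 := by have := d0 0 1; simp at this; linarith
    have t02 : T 0 2 = 0 := by have := d0 0 2; simp at this; linarith
    have t10 : T 1 0 = 0 := by have := d0 1 0; simp at this; linarith
    have t20 : T 2 0 = 0 := by have := d0 2 0; simp at this; linarith
    have t00 : T 0 0 = 0 := by have := d1 0 0; norm_num at this; linarith
    have t11 : T 1 1 = 0 := by have := d1 1 1; norm_num at this; linarith
    have t22 : T 2 2 = 0 := by have := r0 1 1; simpa [t11] using this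
    have t21 : T 2 1 = -T 1 2 := by have := r0 1 2; simpa using this
    rw [key, hξ, ← det_mulVec_mulVec hQ, transpose_mulVec_mulVec hQ', Matrix.det_fin_three]
    simp [Fin.sum_univ_three, t01, t02, t10, t20, t00, t11, t22, t21]
    ring

end Symbol

end Rotations

section Evaluation

/-! ### Evaluation of tensors on vectors -/

theorem sum_fin_succ_pi {n : ℕ} (g : (Fin (n + 1) → Fin 3) → ℝ) :
    ∑ I, g I = ∑ i, ∑ I : Fin n → Fin 3, g (Fin.cons i I) := by
  rw [← Fintype.sum_prod_type', ← (Fin.consEquiv fun _ => Fin 3).sum_comp]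
  rfl

theorem sum_fin_zero_pi (g : (Fin 0 → Fin 3) → ℝ) : ∑ I, g I = g ![] :=
  Fintype.sum_subsingleton g _

theorem sum_fin_four_pi (g : (Fin 4 → Fin 3) → ℝ) :
    ∑ I, g I = ∑ i, ∑ j, ∑ k, ∑ l, g ![i, j, k, l] := by
  simp only [sum_fin_succ_pi, sum_fin_zero_pi]; rfl

theorem sum_fin_five_pi (g : (Fin 5 → Fin 3) → ℝ) :
    ∑ I, g I = ∑ i, ∑ j, ∑ k, ∑ l, ∑ m, g ![i, j, k, l, m] := by
  simp only [sum_fin_succ_pi, sum_fin_zero_pi]; rfl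

theorem sum_fin_six_pi (g : (Fin 6 → Fin 3) → ℝ) :
    ∑ I, g I = ∑ i, ∑ j, ∑ k, ∑ l, ∑ m, ∑ n, g ![i, j, k, l, m, n] := by
  simp only [sum_fin_succ_pi, sum_fin_zero_pi]; rfl

/-- In each slot Q is contracted with Qv, which gives QᵀQv = v. Multi-indices in `Fin n → Fin 3`
allow one proof for all tensor orders. -/
theorem sum_sum_prod_mulVec {n : ℕ} {Q : Matrix (Fin 3) (Fin 3) ℝ} (hQ : Q ∈ O3)
    (A : (Fin n → Fin 3) → ℝ) (v : Fin n → Fin 3 → ℝ) :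
    ∑ I : Fin n → Fin 3, (∑ J : Fin n → Fin 3, (∏ s, Q (I s) (J s)) * A J) *
      ∏ s, (Q *ᵥ v s) (I s) = ∑ J, A J * ∏ s, v s (J s) := by
  simp_rw [Finset.sum_mul]
  rw [Finset.sum_comm]
  refine Finset.sum_congr rfl fun J _ => ?_
  have h (s : Fin n) : v s (J s) = ∑ i, Q i (J s) * (Q *ᵥ v s) i := by
    conv_lhs => rw [← transpose_mulVec_mulVec hQ (v s)]
    rfl
  simp_rw [h, Finset.prod_univ_sum, Fintype.piFinset_univ, Finset.mul_sum, Finset.prod_mul_distrib]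
  exact Finset.sum_congr rfl fun I _ => by ring

def eval4 (C : Tensor4) (v : Fin 4 → Fin 3 → ℝ) : ℝ :=
  ∑ I : Fin 4 → Fin 3, C (I 0) (I 1) (I 2) (I 3) * ∏ s, v s (I s)

def eval5 (M : Tensor5) (v : Fin 5 → Fin 3 → ℝ) : ℝ :=
  ∑ I : Fin 5 → Fin 3, M (I 0) (I 1) (I 2) (I 3) (I 4) * ∏ s, v s (I s)

def eval6 (A : Tensor6) (v : Fin 6 → Fin 3 → ℝ) : ℝ :=
  ∑ I : Fin 6 → Fin 3, A (I 0) (I 1) (I 2) (I 3) (I 4) (I 5) * ∏ s, v s (I s)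

variable {Q : Matrix (Fin 3) (Fin 3) ℝ}

theorem eval4_mulVec (hQ : Q ∈ O3) {C : Tensor4} (h : rotate4 Q C = C)
    (v : Fin 4 → Fin 3 → ℝ) : eval4 C (fun s => Q *ᵥ v s) = eval4 C v := by
  refine Eq.trans (Finset.sum_congr rfl fun I _ => ?_)
    (sum_sum_prod_mulVec hQ (fun I => C (I 0) (I 1) (I 2) (I 3)) v)
  congr 1
  rw [sum_fin_four_pi]
  simp only [Fin.prod_univ_four]
  exact congrArg (fun T : Tensor4 => T (I 0) (I 1) (I 2) (I 3)) h.symm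

theorem eval4_eq (C : Tensor4) (a b c d : Fin 3 → ℝ) :
    eval4 C ![a, b, c, d] =
      ∑ i, ∑ j, ∑ k, ∑ l, C i j k l * (a i * b j * c k * d l) := by
  rw [eval4, sum_fin_four_pi]
  simp only [Fin.prod_univ_four]
  rfl

theorem eval4_mulVec_vec (hQ : Q ∈ O3) {C : Tensor4} (h : rotate4 Q C = C)
    (a b c d : Fin 3 → ℝ) :
    eval4 C ![Q *ᵥ a, Q *ᵥ b, Q *ᵥ c, Q *ᵥ d] =
      eval4 C ![a, b, c, d] := by
  refine Eq.trans (congrArg (eval4 C) ?_) (eval4_mulVec hQ h ![a, b, c, d])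
  funext s
  fin_cases s <;> rfl

theorem eval5_mulVec (hQ : Q ∈ O3) {M : Tensor5} (h : rotate5 Q M = M)
    (v : Fin 5 → Fin 3 → ℝ) : eval5 M (fun s => Q *ᵥ v s) = eval5 M v := by
  refine Eq.trans (Finset.sum_congr rfl fun I _ => ?_)
    (sum_sum_prod_mulVec hQ (fun I => M (I 0) (I 1) (I 2) (I 3) (I 4)) v)
  congr 1
  rw [sum_fin_five_pi]
  simp only [Fin.prod_univ_five]
  exact congrArg (fun T : Tensor5 => T (I 0) (I 1) (I 2) (I 3) (I 4)) h.symm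

theorem eval5_eq (M : Tensor5) (a b c d e : Fin 3 → ℝ) :
    eval5 M ![a, b, c, d, e] =
      ∑ i, ∑ j, ∑ k, ∑ l, ∑ m, M i j k l m * (a i * b j * c k * d l * e m) := by
  rw [eval5, sum_fin_five_pi]
  simp only [Fin.prod_univ_five]
  rfl

theorem eval5_mulVec_vec (hQ : Q ∈ O3) {M : Tensor5} (h : rotate5 Q M = M)
    (a b c d e : Fin 3 → ℝ) :
    eval5 M ![Q *ᵥ a, Q *ᵥ b, Q *ᵥ c, Q *ᵥ d, Q *ᵥ e] =
      eval5 M ![a, b, c, d, e] := by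
  refine Eq.trans (congrArg (eval5 M) ?_) (eval5_mulVec hQ h ![a, b, c, d, e])
  funext s
  fin_cases s <;> rfl

theorem eval6_mulVec (hQ : Q ∈ O3) {A : Tensor6} (h : rotate6 Q A = A)
    (v : Fin 6 → Fin 3 → ℝ) : eval6 A (fun s => Q *ᵥ v s) = eval6 A v := by
  refine Eq.trans (Finset.sum_congr rfl fun I _ => ?_)
    (sum_sum_prod_mulVec hQ (fun I => A (I 0) (I 1) (I 2) (I 3) (I 4) (I 5)) v)
  congr 1
  rw [sum_fin_six_pi]
  simp only [Fin.prod_univ_six]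
  exact congrArg (fun T : Tensor6 => T (I 0) (I 1) (I 2) (I 3) (I 4) (I 5)) h.symm

theorem eval6_eq (A : Tensor6) (a b c d e f : Fin 3 → ℝ) :
    eval6 A ![a, b, c, d, e, f] =
      ∑ i, ∑ j, ∑ k, ∑ l, ∑ m, ∑ n, A i j k l m n * (a i * b j * c k * d l * e m * f n) := by
  rw [eval6, sum_fin_six_pi]
  simp only [Fin.prod_univ_six]
  rfl

theorem eval6_mulVec_vec (hQ : Q ∈ O3) {A : Tensor6} (h : rotate6 Q A = A)
    (a b c d e f : Fin 3 → ℝ) :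
    eval6 A ![Q *ᵥ a, Q *ᵥ b, Q *ᵥ c, Q *ᵥ d, Q *ᵥ e, Q *ᵥ f] =
      eval6 A ![a, b, c, d, e, f] := by
  refine Eq.trans (congrArg (eval6 A) ?_) (eval6_mulVec hQ h ![a, b, c, d, e, f])
  funext s
  fin_cases s <;> rfl

end Evaluation

section IsotropicTensors

/-! ### Isotropic tensors -/

/-- The Levi-Civita symbol. -/
noncomputable def levi (i j k : Fin 3) : ℝ :=
  (((j : ℕ) : ℝ) - (i : ℕ)) * (((k : ℕ) : ℝ) - (j : ℕ)) * (((k : ℕ) : ℝ) - (i : ℕ)) / 2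

/-- The Kronecker symbol. -/
noncomputable def kron (i j : Fin 3) : ℝ := if i = j then 1 else 0

variable {Q : Matrix (Fin 3) (Fin 3) ℝ}

theorem kron_rotate (hQ : Q ∈ O3) (i j : Fin 3) : ∑ o, ∑ p, Q i o * Q j p * kron o p = kron i j := by
  have := congrFun (congrFun (mem_O3_iff.1 hQ) i) j
  simpa [Matrix.mul_apply, Matrix.one_apply, kron] using this

/-- The left side is the determinant of the rows i, j, k of Q, so no orthogonality is needed; all 27
cases are expanded. -/
theorem levi_rotate (Q : Matrix (Fin 3) (Fin 3) ℝ) (i j k : Fin 3) :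
    ∑ o, ∑ p, ∑ q, Q i o * Q j p * Q k q * levi o p q = Q.det * levi i j k := by
  have h : ∀ i : Fin 3, i = 0 ∨ i = 1 ∨ i = 2 := by decide
  simp only [levi, Fin.sum_univ_three, Matrix.det_fin_three]
  rcases h i with rfl | rfl | rfl <;> rcases h j with rfl | rfl | rfl <;>
    rcases h k with rfl | rfl | rfl <;> norm_num <;> ring

/-- The isotropic elasticity tensor with Lamé constants `lam` and `mu`. -/
noncomputable def lameTensor (lam mu : ℝ) : Tensor4 :=
  fun i j l m => lam * (kron i j * kron l m) + mu * (kron i l * kron j m + kron i m * kron j l)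

theorem lameTensor_symm (lam mu : ℝ) : HasSymmetriesC (lameTensor lam mu) := by
  have h (i j : Fin 3) : kron i j = kron j i := by simp only [kron, eq_comm]
  refine ⟨fun i j l m => ?_, fun i j l m => ?_⟩
  · simp only [lameTensor, h j i]; ring
  · simp only [lameTensor, h l i, h m j, h l j, h m i]; ring

theorem rotate4_lameTensor (hQ : Q ∈ O3) (lam mu : ℝ) :
    rotate4 Q (lameTensor lam mu) = lameTensor lam mu := by
  funext i j l m
  have h₁ : ∑ o, ∑ p, ∑ q, ∑ r, (Q i o * Q j p * kron o p) * (Q l q * Q m r * kron q r) =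
      kron i j * kron l m := by
    simp only [← Finset.sum_mul, ← Finset.mul_sum, kron_rotate hQ]
  have h₂ : ∑ o, ∑ p, ∑ q, ∑ r, (Q i o * Q l q * kron o q) * (Q j p * Q m r * kron p r) =
      kron i l * kron j m := by
    simp only [← Finset.sum_mul, ← Finset.mul_sum, kron_rotate hQ]
  have h₃ : ∑ o, ∑ p, ∑ q, ∑ r, (Q i o * Q m r * kron o r) * (Q j p * Q l q * kron p q) =
      kron i m * kron j l := by
    simp only [← Finset.sum_mul, ← Finset.mul_sum, kron_rotate hQ]
  simp only [lameTensor, rotate4]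
  rw [← h₁, ← h₂, ← h₃]
  simp only [Finset.mul_sum, ← Finset.sum_add_distrib]
  exact Finset.sum_congr rfl fun o _ => Finset.sum_congr rfl fun p _ =>
    Finset.sum_congr rfl fun q _ => Finset.sum_congr rfl fun r _ => by ring

theorem symmetryGroupC_lameTensor (lam mu : ℝ) : symmetryGroupC (lameTensor lam mu) = O3 :=
  Set.ext fun _ => ⟨fun h => h.1, fun h => ⟨h, rotate4_lameTensor h lam mu⟩⟩

/-- The isotropic coupling tensor. -/
noncomputable def chiralTensor : Tensor5 := fun i j k l m =>
  levi i k m * kron j l + levi i l m * kron j k + levi j k m * kron i l + levi j l m * kron i k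

theorem chiralTensor_symm : HasSymmetriesM chiralTensor := by
  refine ⟨fun i j k l m => ?_, fun i j k l m => ?_⟩ <;> simp only [chiralTensor] <;> ring

/-- Each summand has one Levi-Civita factor, which yields det Q, and one invariant Kronecker factor.
This sign is what distinguishes `SO(3)` from `O(3)`. -/
theorem rotate5_chiralTensor (hQ : Q ∈ O3) : rotate5 Q chiralTensor = Q.det • chiralTensor := by
  funext i j k l m
  have h₁ : ∑ o, ∑ p, ∑ q, ∑ r, ∑ s, (Q i o * Q k q * Q m s * levi o q s) *
      (Q j p * Q l r * kron p r) = Q.det * levi i k m * kron j l := by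
    simp only [← Finset.sum_mul, ← Finset.mul_sum, kron_rotate hQ, levi_rotate]
  have h₂ : ∑ o, ∑ p, ∑ q, ∑ r, ∑ s, (Q i o * Q l r * Q m s * levi o r s) *
      (Q j p * Q k q * kron p q) = Q.det * levi i l m * kron j k := by
    simp only [← Finset.sum_mul, ← Finset.mul_sum, kron_rotate hQ, levi_rotate]
  have h₃ : ∑ o, ∑ p, ∑ q, ∑ r, ∑ s, (Q j p * Q k q * Q m s * levi p q s) *
      (Q i o * Q l r * kron o r) = Q.det * levi j k m * kron i l := by
    simp only [← Finset.sum_mul, ← Finset.mul_sum, kron_rotate hQ, levi_rotate]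
  have h₄ : ∑ o, ∑ p, ∑ q, ∑ r, ∑ s, (Q j p * Q l r * Q m s * levi p r s) *
      (Q i o * Q k q * kron o q) = Q.det * levi j l m * kron i k := by
    simp only [← Finset.sum_mul, ← Finset.mul_sum, kron_rotate hQ, levi_rotate]
  simp only [chiralTensor, rotate5, Pi.smul_apply, smul_eq_mul, mul_add, ← mul_assoc]
  rw [← h₁, ← h₂, ← h₃, ← h₄]
  simp only [← Finset.sum_add_distrib]
  exact Finset.sum_congr rfl fun o _ => Finset.sum_congr rfl fun p _ =>
    Finset.sum_congr rfl fun q _ => Finset.sum_congr rfl fun r _ =>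
      Finset.sum_congr rfl fun s _ => by ring

theorem chiralTensor_mem : chiralTensor ∈ isotropicCouplingTensors :=
  ⟨chiralTensor_symm, fun Q hQ => ⟨SO3_subset_O3 hQ, by
    rw [rotate5_chiralTensor (SO3_subset_O3 hQ), (mem_SO3_iff.1 hQ).2, one_smul]⟩⟩

theorem rotate5_signedPerm (σ : Fin 3 → Fin 3) (s : Fin 3 → ℝ) (M : Tensor5) (i j k l m : Fin 3) :
    rotate5 (signedPerm σ s) M i j k l m =
      s i * s j * s k * s l * s m * M (σ i) (σ j) (σ k) (σ l) (σ m) := by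
  simp [rotate5, signedPerm]

/-- Signed permutations alone leave three independent coupling components. This rotation, with
rational entries and outside that finite group, supplies the missing relations. -/
theorem pythagorean_mem_SO3 : (Matrix.of ![![3 / 5, 4 / 5, 0], ![-4 / 5, 3 / 5, 0], ![0, 0, 1]] :
    Matrix (Fin 3) (Fin 3) ℝ) ∈ SO3 := by
  refine mem_SO3_iff.2 ⟨mem_O3_iff.2 ?_, ?_⟩
  · ext i j
    fin_cases i <;> fin_cases j <;> simp [Matrix.mul_apply, Fin.sum_univ_three] <;> norm_num
  · simp [Matrix.det_fin_three]; norm_num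

/-- Representatives, up to the index symmetries of coupling tensors, of the index tuples in which `0`
occurs three times and `1` and `2` occur once. -/
def thriceZero : List (List (Fin 3)) :=
  [[0, 1, 0, 2, 0], [0, 1, 0, 0, 2], [0, 0, 0, 1, 2], [1, 2, 0, 0, 0],
    [0, 0, 1, 2, 0], [0, 2, 0, 1, 0], [0, 2, 0, 0, 1], [0, 0, 0, 2, 1]]

/-- The index tuples that the index symmetries of coupling tensors carry into `thriceZero`. -/
def isThriceZero (i j k l m : Fin 3) : Bool :=
  decide ([i, j, k, l, m] ∈ thriceZero ∨ [j, i, k, l, m] ∈ thriceZero ∨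
    [i, j, l, k, m] ∈ thriceZero ∨ [j, i, l, k, m] ∈ thriceZero)

/-- The index tuples in which the number of nonzero indices is odd. -/
def isOddIndex (i j k l m : Fin 3) : Bool :=
  decide (Odd ((if i = 0 then 0 else 1) + (if j = 0 then 0 else 1) + (if k = 0 then 0 else 1) +
      (if l = 0 then 0 else 1) + (if m = 0 then 0 else 1)))

/-- If no parity argument applies, each of 0, 1, 2 occurs an odd number of times among five indices,
hence with multiplicities 3, 1, 1. A cyclic shift then makes 0 the threefold index. -/
theorem index_cases : ∀ i j k l m : Fin 3,
    isOddIndex i j k l m ∨ isOddIndex (i + 1) (j + 1) (k + 1) (l + 1) (m + 1) ∨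
    isThriceZero i j k l m ∨ isThriceZero (i + 1) (j + 1) (k + 1) (l + 1) (m + 1) ∨
    isThriceZero (i + 1 + 1) (j + 1 + 1) (k + 1 + 1) (l + 1 + 1) (m + 1 + 1) := by
  decide +kernel

/-! ### One-dimensionality of the space of isotropic coupling tensors -/

section Coupling

variable {M : Tensor5} (hM : M ∈ isotropicCouplingTensors)
include hM

theorem coupling_signedPerm {σ : Fin 3 → Fin 3} {s : Fin 3 → ℝ} (h : signedPerm σ s ∈ SO3)
    (i j k l m : Fin 3) :
    M i j k l m = s i * s j * s k * s l * s m * M (σ i) (σ j) (σ k) (σ l) (σ m) := by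
  rw [← rotate5_signedPerm, (hM.2 h).2]

theorem coupling_eq_zero_of_parity (i j k l m : Fin 3)
    (h : isOddIndex i j k l m) : M i j k l m = 0 := by
  have h := of_decide_eq_true h
  have d0 := coupling_signedPerm hM diag0_mem_SO3 i j k l m
  have hs (i : Fin 3) : (![1, -1, -1] : Fin 3 → ℝ) i = (-1) ^ (if i = 0 then 0 else 1) := by
    fin_cases i <;> simp
  simp only [hs, ← pow_add, h.neg_one_pow, id] at d0
  linarith

/-- The components 00002 and 00200 vanish by parity. Expanding them after the 3-4-5 rotation about
the third axis gives two linear equations; quarter turns and index symmetries reduce the unknowns to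
the three components in the statement. -/
theorem coupling_relations :
    M 0 1 0 0 2 = -2 * M 0 1 0 2 0 ∧ M 0 0 0 1 2 = 2 * M 0 1 0 2 0 := by
  have h := (hM.2 pythagorean_mem_SO3).2
  have s₁ := hM.1.1
  have s₂ := hM.1.2
  have z := coupling_eq_zero_of_parity hM
  have q0 := coupling_signedPerm hM quarter0_mem_SO3
  have q2 := coupling_signedPerm hM quarter2_mem_SO3
  have h₁ := congrArg (fun T : Tensor5 => T 0 0 0 0 2) h
  have h₂ := congrArg (fun T : Tensor5 => T 0 0 2 0 0) h
  have a₁ := q2 0 1 1 1 2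
  have a₂ := q2 1 0 1 1 2
  have a₃ := q2 1 1 0 1 2
  have a₄ := q2 1 1 1 0 2
  have b₁ := q2 0 1 2 1 1
  have b₂ := q2 1 0 2 1 1
  have b₃ := q2 1 1 2 0 1
  have b₄ := q2 1 1 2 1 0
  have c₁ := q0 0 0 2 0 1
  have c₂ := q0 0 0 2 1 0
  simp at a₁ a₂ a₃ a₄ b₁ b₂ b₃ b₄ c₁ c₂
  simp [rotate5, Fin.sum_univ_three, z 0 0 0 0 2 (by decide), z 0 0 1 1 2 (by decide),
    z 0 1 0 1 2 (by decide), z 0 1 1 0 2 (by decide), z 1 0 0 1 2 (by decide),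
    z 1 0 1 0 2 (by decide), z 1 1 0 0 2 (by decide), z 1 1 1 1 2 (by decide)] at h₁
  simp [rotate5, Fin.sum_univ_three, z 0 0 2 0 0 (by decide), z 0 0 2 1 1 (by decide),
    z 0 1 2 0 1 (by decide), z 0 1 2 1 0 (by decide), z 1 0 2 0 1 (by decide),
    z 1 0 2 1 0 (by decide), z 1 1 2 0 0 (by decide), z 1 1 2 1 1 (by decide)] at h₂
  constructor <;>
  linarith [s₂ 0 0 1 0 2, s₁ 1 0 0 0 2, s₂ 0 0 1 2 0, s₂ 0 1 0 2 0, s₁ 1 0 2 0 0]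

/-- An isotropic coupling tensor is determined by one of its components. -/
theorem coupling_eq_zero (h0 : M 0 1 0 2 0 = 0) : M = 0 := by
  obtain ⟨r₁, r₂⟩ := coupling_relations hM
  rw [h0, mul_zero] at r₁ r₂
  have s₁ := hM.1.1
  have s₂ := hM.1.2
  have q0 := coupling_signedPerm hM quarter0_mem_SO3
  -- Cyclic permutation of the axes is the shift by one modulo three, so only tuples with a
  -- threefold 0 have to be treated.
  have cyc (i j k l m : Fin 3) : M i j k l m = M (i + 1) (j + 1) (k + 1) (l + 1) (m + 1) := by
    simpa using coupling_signedPerm hM cyclic_mem_SO3 i j k l m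
  -- The quarter turn about the first axis swaps 1 and 2 with a sign. If 1 and 2 form a symmetric
  -- pair the component equals its negative; otherwise it reduces to one already known to vanish.
  have e₁ : M 1 2 0 0 0 = 0 := by have := q0 1 2 0 0 0; simp at this; linarith [s₁ 1 2 0 0 0]
  have e₂ : M 0 0 1 2 0 = 0 := by have := q0 0 0 1 2 0; simp at this; linarith [s₂ 0 0 1 2 0]
  have e₃ : M 0 2 0 1 0 = 0 := by have := q0 0 2 0 1 0; simp at this; linarith
  have e₄ : M 0 2 0 0 1 = 0 := by have := q0 0 2 0 0 1; simp at this; linarith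
  have e₅ : M 0 0 0 2 1 = 0 := by have := q0 0 0 0 2 1; simp at this; linarith
  have major (i j k l m : Fin 3) (h : [i, j, k, l, m] ∈ thriceZero) : M i j k l m = 0 := by
    simp only [thriceZero, List.mem_cons, List.cons.injEq, List.not_mem_nil, or_false] at h
    rcases h with h | h | h | h | h | h | h | h <;> obtain ⟨rfl, rfl, rfl, rfl, rfl, -⟩ := h <;>
      assumption
  have major' (i j k l m : Fin 3) (h : isThriceZero i j k l m) : M i j k l m = 0 := by
    have h := of_decide_eq_true h
    rcases h with h | h | h | h
    · exact major _ _ _ _ _ h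
    · rw [s₁]; exact major _ _ _ _ _ h
    · rw [s₂]; exact major _ _ _ _ _ h
    · rw [s₁, s₂]; exact major _ _ _ _ _ h
  have z := coupling_eq_zero_of_parity hM
  funext i j k l m
  rcases index_cases i j k l m with h | h | h | h | h
  · exact z _ _ _ _ _ h
  · rw [cyc]; exact z _ _ _ _ _ h
  · exact major' _ _ _ _ _ h
  · rw [cyc]; exact major' _ _ _ _ _ h
  · rw [cyc, cyc]; exact major' _ _ _ _ _ h

theorem coupling_eq_smul : M = M 0 1 0 2 0 • chiralTensor := by
  rw [← sub_eq_zero]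
  refine coupling_eq_zero
    (isotropicCouplingTensors.sub_mem hM (isotropicCouplingTensors.smul_mem _ chiralTensor_mem)) ?_
  norm_num [chiralTensor, levi, kron]

end Coupling

theorem chiralTensor_apply : chiralTensor 0 1 0 2 0 = 1 := by
  norm_num [chiralTensor, levi, kron]

/-- A linear isomorphism of the space of isotropic coupling tensors onto `ℝ`. -/
noncomputable def couplingEquiv (c : ℝ) (hc : c ≠ 0) : isotropicCouplingTensors ≃ₗ[ℝ] ℝ :=
  LinearEquiv.ofBijective
    { toFun := fun M => c * M.1 0 1 0 2 0
      map_add' := fun M N => by simp [mul_add]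
      map_smul' := fun a M => by simp [mul_left_comm] }
    ⟨(injective_iff_map_eq_zero _).2 fun M hM =>
      Subtype.ext (coupling_eq_zero M.2 ((mul_eq_zero.1 hM).resolve_left hc)),
    fun y => ⟨(y / c) • ⟨chiralTensor, chiralTensor_mem⟩, by
      simp [chiralTensor_apply, mul_div_cancel₀ _ hc]⟩⟩

theorem couplingEquiv_apply (c : ℝ) (hc : c ≠ 0) (M : isotropicCouplingTensors) :
    couplingEquiv c hc M = c * M.1 0 1 0 2 0 := rfl

end IsotropicTensors

section Symbols

/-! ### Differential operators with rotation-invariant symbols -/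

theorem dotProduct_single_single (k l : Fin 3) :
    (Pi.single k 1 : Fin 3 → ℝ) ⬝ᵥ Pi.single l 1 = kron k l := by
  simp [kron, Pi.single_apply, eq_comm]

theorem det_single_single (ξ : Fin 3 → ℝ) (k l : Fin 3) :
    (Matrix.of ![ξ, Pi.single k 1, Pi.single l 1]).det = ∑ j, levi j k l * ξ j := by
  have h : ∀ i : Fin 3, i = 0 ∨ i = 1 ∨ i = 2 := by decide
  simp only [levi, Fin.sum_univ_three, Matrix.det_fin_three]
  rcases h k with rfl | rfl | rfl <;> rcases h l with rfl | rfl | rfl <;>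
    simp <;> norm_num

/-- At ξ = e₀ the symbol matrix is `C 0 k l 0`, with entries μ = `C 0 1 1 0` and λ + 2μ = `C 0 0 0
0`. -/
theorem symbol_C {C : Tensor4} (hC : SO3 ⊆ symmetryGroupC C) (k l : Fin 3) (ξ : Fin 3 → ℝ) :
    ∑ i, ∑ m, C i k l m * (ξ i * ξ m) =
      C 0 1 1 0 * kron k l * (ξ ⬝ᵥ ξ) + (C 0 0 0 0 - C 0 1 1 0) * (ξ k * ξ l) := by
  have h := symbol_even (n := 2) (m := 0) (B := fun ξ a b => eval4 C ![ξ, a, b, ξ])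
    (T := fun k l => C 0 k l 0) rfl
    (fun Q hQ ξ a b => eval4_mulVec_vec (hC hQ).1 (hC hQ).2 ξ a b ξ)
    (fun c ξ a b => by
      simp only [eval4_eq, Finset.mul_sum, Pi.smul_apply, smul_eq_mul]
      exact Finset.sum_congr rfl fun _ _ => Finset.sum_congr rfl fun _ _ =>
        Finset.sum_congr rfl fun _ _ => Finset.sum_congr rfl fun _ _ => by ring)
    (fun a b => by simp [eval4_eq, Pi.single_apply]) ξ (Pi.single k 1) (Pi.single l 1)
  simp only [dotProduct_single_single, eval4_eq] at h
  simp [Pi.single_apply] at h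
  rw [h]
  ring

theorem symbol_A {A : Tensor6} (hA : SO3 ⊆ symmetryGroupA A) (k l : Fin 3)
    (ξ : Fin 3 → ℝ) :
      ∑ i, ∑ j, ∑ n, ∑ m, A i j k l m n * (ξ i * ξ j * ξ n * ξ m) =
        A 0 0 1 1 0 0 * kron k l * (ξ ⬝ᵥ ξ) ^ 2 +
          (A 0 0 0 0 0 0 - A 0 0 1 1 0 0) * ((ξ ⬝ᵥ ξ) * (ξ k * ξ l)) := by
  have h := symbol_even (n := 4) (m := 1) (B := fun ξ a b => eval6 A ![ξ, ξ, a, b, ξ, ξ])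
    (T := fun k l => A 0 0 k l 0 0) rfl
    (fun Q hQ ξ a b => eval6_mulVec_vec (hA hQ).1 (hA hQ).2 ξ ξ a b ξ ξ)
    (fun c ξ a b => by
      simp only [eval6_eq, Finset.mul_sum, Pi.smul_apply, smul_eq_mul]
      exact Finset.sum_congr rfl fun _ _ => Finset.sum_congr rfl fun _ _ =>
        Finset.sum_congr rfl fun _ _ => Finset.sum_congr rfl fun _ _ =>
        Finset.sum_congr rfl fun _ _ => Finset.sum_congr rfl fun _ _ => by ring)
    (fun a b => by simp [eval6_eq, Pi.single_apply]) ξ (Pi.single k 1) (Pi.single l 1)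
  simp only [dotProduct_single_single, eval6_eq] at h
  simp [Pi.single_apply] at h
  rw [← mul_assoc, mul_right_comm] at h
  rw [← h]
  refine Finset.sum_congr rfl fun _ _ => Finset.sum_congr rfl fun _ _ => ?_
  rw [Finset.sum_comm]
  exact Finset.sum_congr rfl fun _ _ => Finset.sum_congr rfl fun _ _ => by ring

/-- With the free index in the middle slot the transverse entry becomes `A 0 1 0 1 0 0`, while the
longitudinal entry is `A 0 0 0 0 0 0` for both placements. -/
theorem symbol_A' {A : Tensor6} (hA : SO3 ⊆ symmetryGroupA A) (k l : Fin 3)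
    (ξ : Fin 3 → ℝ) :
      ∑ i, ∑ j, ∑ n, ∑ m, A i k j l m n * (ξ i * ξ j * ξ n * ξ m) =
        A 0 1 0 1 0 0 * kron k l * (ξ ⬝ᵥ ξ) ^ 2 +
          (A 0 0 0 0 0 0 - A 0 1 0 1 0 0) * ((ξ ⬝ᵥ ξ) * (ξ k * ξ l)) := by
  have h := symbol_even (n := 4) (m := 1) (B := fun ξ a b => eval6 A ![ξ, a, ξ, b, ξ, ξ])
    (T := fun k l => A 0 k 0 l 0 0) rfl
    (fun Q hQ ξ a b => eval6_mulVec_vec (hA hQ).1 (hA hQ).2 ξ a ξ b ξ ξ)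
    (fun c ξ a b => by
      simp only [eval6_eq, Finset.mul_sum, Pi.smul_apply, smul_eq_mul]
      exact Finset.sum_congr rfl fun _ _ => Finset.sum_congr rfl fun _ _ =>
        Finset.sum_congr rfl fun _ _ => Finset.sum_congr rfl fun _ _ =>
        Finset.sum_congr rfl fun _ _ => Finset.sum_congr rfl fun _ _ => by ring)
    (fun a b => by simp [eval6_eq, Pi.single_apply]) ξ (Pi.single k 1) (Pi.single l 1)
  simp only [dotProduct_single_single, eval6_eq] at h
  simp [Pi.single_apply] at h
  rw [← mul_assoc, mul_right_comm] at h
  rw [← h]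
  refine Finset.sum_congr rfl fun _ _ => Finset.sum_congr rfl fun _ _ => ?_
  rw [Finset.sum_comm]
  exact Finset.sum_congr rfl fun _ _ => Finset.sum_congr rfl fun _ _ => by ring

/-- `M` enters the force twice, through the stress and, with its index groups exchanged, through the
hyperstress; the difference is a single invariant symbol of degree three. -/
theorem symbol_M {M : Tensor5} (hM : M ∈ isotropicCouplingTensors) (k l : Fin 3) (ξ : Fin 3 → ℝ) :
    ∑ i, ∑ j, ∑ m, (M i k l m j - M l m i j k) * (ξ i * ξ j * ξ m) =
      -M 0 1 0 2 0 * ((ξ ⬝ᵥ ξ) * ∑ j, levi j k l * ξ j) := by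
  have h := symbol_three
    (B := fun ξ a b => eval5 M ![ξ, a, b, ξ, ξ] - eval5 M ![b, ξ, ξ, ξ, a])
    (T := fun k l => M 0 k l 0 0 - M l 0 0 0 k)
    (fun Q hQ ξ a b => congrArg₂ (· - ·)
      (eval5_mulVec_vec (hM.2 hQ).1 (hM.2 hQ).2 ξ a b ξ ξ)
      (eval5_mulVec_vec (hM.2 hQ).1 (hM.2 hQ).2 b ξ ξ ξ a))
    (fun c ξ a b => by
      simp only [eval5_eq, mul_sub, Finset.mul_sum, Pi.smul_apply, smul_eq_mul]
      refine congrArg₂ (· - ·) ?_ ?_ <;>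
      exact Finset.sum_congr rfl fun _ _ => Finset.sum_congr rfl fun _ _ =>
        Finset.sum_congr rfl fun _ _ => Finset.sum_congr rfl fun _ _ =>
        Finset.sum_congr rfl fun _ _ => by ring)
    (fun a b => by
      simp [eval5_eq, Pi.single_apply, sub_mul]
      rw [Finset.sum_comm]
      exact Finset.sum_congr rfl fun _ _ => Finset.sum_congr rfl fun _ _ => by ring)
    ξ (Pi.single k 1) (Pi.single l 1)
  -- On `chiralTensor` the two components are 1 and 2.
  have hc : M 0 1 2 0 0 - M 2 0 0 0 1 = -M 0 1 0 2 0 := by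
    rw [coupling_eq_smul hM]
    norm_num [chiralTensor, levi, kron]
    ring
  simp only [det_single_single, eval5_eq, hc] at h
  simp [Pi.single_apply] at h
  rw [neg_mul, ← h]
  simp only [sub_mul, Finset.sum_sub_distrib]
  refine congrArg₂ (· - ·) (Finset.sum_congr rfl fun _ _ => Eq.trans ?_ Finset.sum_comm)
    (Eq.trans (Finset.sum_congr rfl fun _ _ => Eq.trans ?_ Finset.sum_comm) Finset.sum_comm) <;>
  exact Finset.sum_congr rfl fun _ _ => Finset.sum_congr rfl fun _ _ => by ring

theorem symbol_M' {M : Tensor5} (hM : M ∈ isotropicCouplingTensors) (k l : Fin 3) (ξ : Fin 3 → ℝ) :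
    ∑ i, ∑ j, ∑ m, (M i k l m j - M l m i k j) * (ξ i * ξ j * ξ m) =
      2 * M 0 1 0 2 0 * ((ξ ⬝ᵥ ξ) * ∑ j, levi j k l * ξ j) := by
  have h := symbol_three
    (B := fun ξ a b => eval5 M ![ξ, a, b, ξ, ξ] - eval5 M ![b, ξ, ξ, a, ξ])
    (T := fun k l => M 0 k l 0 0 - M l 0 0 k 0)
    (fun Q hQ ξ a b => congrArg₂ (· - ·)
      (eval5_mulVec_vec (hM.2 hQ).1 (hM.2 hQ).2 ξ a b ξ ξ)
      (eval5_mulVec_vec (hM.2 hQ).1 (hM.2 hQ).2 b ξ ξ a ξ))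
    (fun c ξ a b => by
      simp only [eval5_eq, mul_sub, Finset.mul_sum, Pi.smul_apply, smul_eq_mul]
      refine congrArg₂ (· - ·) ?_ ?_ <;>
      exact Finset.sum_congr rfl fun _ _ => Finset.sum_congr rfl fun _ _ =>
        Finset.sum_congr rfl fun _ _ => Finset.sum_congr rfl fun _ _ =>
        Finset.sum_congr rfl fun _ _ => by ring)
    (fun a b => by
      simp [eval5_eq, Pi.single_apply, sub_mul]
      rw [Finset.sum_comm]
      exact Finset.sum_congr rfl fun _ _ => Finset.sum_congr rfl fun _ _ => by ring)
    ξ (Pi.single k 1) (Pi.single l 1)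
  -- On `chiralTensor` the two components are 1 and −1, so this placement also gives a nonzero
  -- multiple.
  have hc : M 0 1 2 0 0 - M 2 0 0 1 0 = 2 * M 0 1 0 2 0 := by
    rw [coupling_eq_smul hM]
    norm_num [chiralTensor, levi, kron]
    ring
  simp only [det_single_single, eval5_eq, hc] at h
  simp [Pi.single_apply] at h
  rw [← h]
  simp only [sub_mul, Finset.sum_sub_distrib]
  refine congrArg₂ (· - ·) (Finset.sum_congr rfl fun _ _ => Eq.trans ?_ Finset.sum_comm)
    (Eq.trans (Finset.sum_congr rfl fun _ _ => Eq.trans ?_ Finset.sum_comm) Finset.sum_comm) <;>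
  exact Finset.sum_congr rfl fun _ _ => Finset.sum_congr rfl fun _ _ => by ring

end Symbols

section ForceOperator

/-! ### The internal force as a differential operator in the displacement -/

variable {Ω : Set E3} {f : E3 → ℝ} {x : E3} {u : E3 → E3}

theorem sum_pd2_eq_zero (hΩ : IsOpen Ω) (hf : ContDiffOn ℝ 2 f Ω) (hx : x ∈ Ω)
    (T : Fin 3 → Fin 3 → ℝ) (h : ∀ ξ : Fin 3 → ℝ, ∑ i, ∑ j, T i j * (ξ i * ξ j) = 0) :
    ∑ i, ∑ j, T i j * pd i (pd j f) x = 0 := by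
  have := sum_pdList_eq_zero (ι := Fin 3 × Fin 3) hΩ (fun p => [p.1, p.2]) (fun p => T p.1 p.2)
    (fun ξ => by simpa [Fintype.sum_prod_type] using h ξ) (fun _ => hf) hx
  simpa [Fintype.sum_prod_type, pdList] using this

theorem sum_pd3_eq_zero (hΩ : IsOpen Ω) (hf : ContDiffOn ℝ 3 f Ω) (hx : x ∈ Ω)
    (T : Fin 3 → Fin 3 → Fin 3 → ℝ)
    (h : ∀ ξ : Fin 3 → ℝ, ∑ i, ∑ j, ∑ m, T i j m * (ξ i * ξ j * ξ m) = 0) :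
    ∑ i, ∑ j, ∑ m, T i j m * pd i (pd j (pd m f)) x = 0 := by
  have := sum_pdList_eq_zero (ι := Fin 3 × Fin 3 × Fin 3) hΩ (fun p => [p.1, p.2.1, p.2.2])
    (fun p => T p.1 p.2.1 p.2.2)
    (fun ξ => by simpa [Fintype.sum_prod_type, mul_assoc] using h ξ) (fun _ => hf) hx
  simpa [Fintype.sum_prod_type, pdList] using this

theorem sum_pd4_eq_zero (hΩ : IsOpen Ω) (hf : ContDiffOn ℝ 4 f Ω) (hx : x ∈ Ω)
    (T : Fin 3 → Fin 3 → Fin 3 → Fin 3 → ℝ)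
    (h : ∀ ξ : Fin 3 → ℝ, ∑ i, ∑ j, ∑ n, ∑ m, T i j n m * (ξ i * ξ j * ξ n * ξ m) = 0) :
    ∑ i, ∑ j, ∑ n, ∑ m, T i j n m * pd i (pd j (pd n (pd m f))) x = 0 := by
  have := sum_pdList_eq_zero (ι := Fin 3 × Fin 3 × Fin 3 × Fin 3) hΩ
    (fun p => [p.1, p.2.1, p.2.2.1, p.2.2.2]) (fun p => T p.1 p.2.1 p.2.2.1 p.2.2.2)
    (fun ξ => by simpa [Fintype.sum_prod_type, mul_assoc] using h ξ) (fun _ => hf) hx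
  simpa [Fintype.sum_prod_type, pdList] using this

/-- The right side is itself the operator of a tensor built from Kronecker symbols. Subtracting that
tensor leaves a zero symbol; the versions of order three and four work the same way. -/
theorem sum_pd2_of_symbol (hΩ : IsOpen Ω) (hf : ContDiffOn ℝ 2 f Ω) (hx : x ∈ Ω)
    (T : Fin 3 → Fin 3 → ℝ) {a b : ℝ} {k l : Fin 3} (h : ∀ ξ : Fin 3 → ℝ,
      ∑ i, ∑ j, T i j * (ξ i * ξ j) = a * (ξ ⬝ᵥ ξ) + b * (ξ k * ξ l)) :
    ∑ i, ∑ j, T i j * pd i (pd j f) x = a * ∑ i, pd i (pd i f) x + b * pd k (pd l f) x := by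
  have := sum_pd2_eq_zero hΩ hf hx
    (fun i j => T i j - (a * kron i j + b * (kron i k * kron j l))) (fun ξ => by
      simp only [sub_mul, add_mul, Finset.sum_sub_distrib, Finset.sum_add_distrib, h ξ]
      simp [kron, dotProduct, Finset.mul_sum])
  simp only [sub_mul, add_mul, Finset.sum_sub_distrib, Finset.sum_add_distrib] at this
  rw [sub_eq_zero.1 this]
  simp [kron, Finset.mul_sum]

theorem sum_pd3_of_symbol (hΩ : IsOpen Ω) (hf : ContDiffOn ℝ 3 f Ω) (hx : x ∈ Ω)
    (T : Fin 3 → Fin 3 → Fin 3 → ℝ) {a : ℝ} {v : Fin 3 → ℝ} (h : ∀ ξ : Fin 3 → ℝ,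
      ∑ i, ∑ j, ∑ m, T i j m * (ξ i * ξ j * ξ m) = a * ((ξ ⬝ᵥ ξ) * ∑ j, v j * ξ j)) :
    ∑ i, ∑ j, ∑ m, T i j m * pd i (pd j (pd m f)) x =
      a * ∑ i, ∑ m, v m * pd i (pd i (pd m f)) x := by
  have := sum_pd3_eq_zero hΩ hf hx (fun i j m => T i j m - a * (kron i j * v m)) (fun ξ => by
      simp only [sub_mul, Finset.sum_sub_distrib, h ξ]
      simp only [kron, dotProduct, Finset.mul_sum, Finset.sum_mul]
      simp
      rw [sub_eq_zero, Finset.sum_comm]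
      exact Finset.sum_congr rfl fun _ _ => Finset.sum_congr rfl fun _ _ => by ring)
  simp only [sub_mul, Finset.sum_sub_distrib] at this
  rw [sub_eq_zero.1 this]
  simp [kron, Finset.mul_sum, mul_assoc]

theorem sum_pd4_of_symbol (hΩ : IsOpen Ω) (hf : ContDiffOn ℝ 4 f Ω) (hx : x ∈ Ω)
    (T : Fin 3 → Fin 3 → Fin 3 → Fin 3 → ℝ) {a b : ℝ} {k l : Fin 3} (h : ∀ ξ : Fin 3 → ℝ,
      ∑ i, ∑ j, ∑ n, ∑ m, T i j n m * (ξ i * ξ j * ξ n * ξ m) =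
        a * (ξ ⬝ᵥ ξ) ^ 2 + b * ((ξ ⬝ᵥ ξ) * (ξ k * ξ l))) :
    ∑ i, ∑ j, ∑ n, ∑ m, T i j n m * pd i (pd j (pd n (pd m f))) x =
      a * ∑ i, ∑ j, pd i (pd i (pd j (pd j f))) x + b * ∑ i, pd i (pd i (pd k (pd l f))) x := by
  have := sum_pd4_eq_zero hΩ hf hx (fun i j n m => T i j n m -
    (a * (kron i j * kron n m) + b * (kron i j * (kron n k * kron m l)))) (fun ξ => by
      simp only [sub_mul, add_mul, Finset.sum_sub_distrib, Finset.sum_add_distrib, h ξ]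
      simp [kron, dotProduct, Finset.mul_sum, pow_two, Finset.sum_mul, mul_assoc]
      rw [Finset.sum_comm, sub_self])
  simp only [sub_mul, add_mul, Finset.sum_sub_distrib, Finset.sum_add_distrib] at this
  rw [sub_eq_zero.1 this]
  simp [kron, Finset.mul_sum]

theorem sum_symm_mul_half {S g : Fin 3 → Fin 3 → ℝ} (hS : ∀ l m, S l m = S m l) :
    ∑ l, ∑ m, S l m * ((g l m + g m l) / 2) = ∑ l, ∑ m, S l m * g l m := by
  have h : ∑ l, ∑ m, S l m * g m l = ∑ l, ∑ m, S l m * g l m := by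
    rw [Finset.sum_comm]
    exact Finset.sum_congr rfl fun _ _ => Finset.sum_congr rfl fun _ _ => by rw [hS]
  have h₂ : ∑ l, ∑ m, S l m * ((g l m + g m l) / 2) =
      (∑ l, ∑ m, S l m * g l m + ∑ l, ∑ m, S l m * g m l) / 2 := by
    simp only [← Finset.sum_add_distrib, Finset.sum_div]
    exact Finset.sum_congr rfl fun _ _ => Finset.sum_congr rfl fun _ _ => by ring
  rw [h₂, h]
  ring

theorem differentiableAt_of_contDiffOn {n : WithTop ℕ∞} (hΩ : IsOpen Ω) (hf : ContDiffOn ℝ n f Ω)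
    (hn : 1 ≤ n) (hx : x ∈ Ω) : DifferentiableAt ℝ f x :=
  (hf.contDiffAt (hΩ.mem_nhds hx)).differentiableAt (by positivity)

/-- A linear combination of the strain and its first derivatives, expressed by the displacement. -/
theorem sum_strain_eq (hΩ : IsOpen Ω) (hu : ContDiffOn ℝ 2 u Ω) (hx : x ∈ Ω)
    {S : Fin 3 → Fin 3 → ℝ} {R : Fin 3 → Fin 3 → Fin 3 → ℝ} (hS : ∀ l m, S l m = S m l)
    (hR : ∀ l m n, R l m n = R m l n) :
    (∑ l, ∑ m, S l m * strain u l m x) + ∑ l, ∑ m, ∑ n, R l m n * pd n (strain u l m) x =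
      (∑ l, ∑ m, S l m * pd m (fun y => u y l) x) +
        ∑ l, ∑ n, ∑ m, R l m n * pd n (pd m fun y => u y l) x := by
  have hd (m l : Fin 3) : DifferentiableAt ℝ (pd m fun y => u y l) x :=
    differentiableAt_of_contDiffOn hΩ
      (contDiffOn_pd (m := 1) hΩ (contDiffOn_apply hu l) (by norm_num) m) le_rfl hx
  have hs (n l m : Fin 3) : pd n (strain u l m) x =
      (pd n (pd m fun y => u y l) x + pd n (pd l fun y => u y m) x) / 2 := by
    have := (((hd m l).hasFDerivAt.add (hd l m).hasFDerivAt).mul_const (1 / 2 : ℝ)).fderiv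
    have h2 : strain u l m =
        fun y => (pd m (fun y => u y l) y + pd l (fun y => u y m) y) * (1 / 2) := by
      funext y; simp only [strain]; ring
    rw [h2]
    refine (congrArg (fun L => L (EuclideanSpace.single n (1 : ℝ))) this).trans ?_
    simp only [pd, add_apply, smul_apply, smul_eq_mul]
    ring
  congr 1
  · exact sum_symm_mul_half (g := fun l m => pd m (fun y => u y l) x) hS
  · have h (F : Fin 3 → Fin 3 → Fin 3 → ℝ) : ∑ l, ∑ m, ∑ n, F l m n = ∑ n, ∑ l, ∑ m, F l m n :=
      (Finset.sum_congr rfl fun _ _ => Finset.sum_comm).trans Finset.sum_comm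
    rw [h, Finset.sum_comm (f := fun l n => ∑ m, R l m n * pd n (pd m fun y => u y l) x)]
    refine Finset.sum_congr rfl fun n _ => ?_
    simp only [hs]
    exact sum_symm_mul_half (g := fun l m => pd n (pd m fun y => u y l) x) fun l m => hR l m n

theorem pd_lincomb {S : Fin 3 → Fin 3 → ℝ} {R : Fin 3 → Fin 3 → Fin 3 → ℝ}
    {F : Fin 3 → Fin 3 → E3 → ℝ} {G : Fin 3 → Fin 3 → Fin 3 → E3 → ℝ}
    (hF : ∀ l m, DifferentiableAt ℝ (F l m) x) (hG : ∀ l n m, DifferentiableAt ℝ (G l n m) x)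
    (i : Fin 3) :
    pd i (fun y => (∑ l, ∑ m, S l m * F l m y) + ∑ l, ∑ n, ∑ m, R l m n * G l n m y) x =
      (∑ l, ∑ m, S l m * pd i (F l m) x) + ∑ l, ∑ n, ∑ m, R l m n * pd i (G l n m) x := by
  have h₁ : ∀ l m, DifferentiableAt ℝ (fun y => S l m * F l m y) x :=
    fun l m => (hF l m).const_mul _
  have h₂ : ∀ l n m, DifferentiableAt ℝ (fun y => R l m n * G l n m y) x :=
    fun l n m => (hG l n m).const_mul _
  have h₁' : ∀ l, DifferentiableAt ℝ (fun y => ∑ m, S l m * F l m y) x :=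
    fun l => DifferentiableAt.fun_sum fun m _ => h₁ l m
  have h₂' : ∀ l n, DifferentiableAt ℝ (fun y => ∑ m, R l m n * G l n m y) x :=
    fun l n => DifferentiableAt.fun_sum fun m _ => h₂ l n m
  have h₂'' : ∀ l, DifferentiableAt ℝ (fun y => ∑ n, ∑ m, R l m n * G l n m y) x :=
    fun l => DifferentiableAt.fun_sum fun n _ => h₂' l n
  rw [pd_add (DifferentiableAt.fun_sum fun l _ => h₁' l) (DifferentiableAt.fun_sum fun l _ => h₂'' l),
    pd_sum h₁', pd_sum h₂'']
  congr 1
  · exact Finset.sum_congr rfl fun l _ => pd_sum_mul _ (hF l) i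
  · refine Finset.sum_congr rfl fun l _ => ?_
    rw [pd_sum (h₂' l)]
    exact Finset.sum_congr rfl fun n _ => pd_sum_mul _ (hG l n) i

section Stress

variable {S : Fin 3 → Fin 3 → ℝ} {R : Fin 3 → Fin 3 → Fin 3 → ℝ}

theorem pd_sum_strain (hΩ : IsOpen Ω) (hu : ContDiffOn ℝ 3 u Ω) (hS : ∀ l m, S l m = S m l)
    (hR : ∀ l m n, R l m n = R m l n) (i : Fin 3) : ∀ x ∈ Ω,
    pd i (fun y => (∑ l, ∑ m, S l m * strain u l m y) +
        ∑ l, ∑ m, ∑ n, R l m n * pd n (strain u l m) y) x =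
      (∑ l, ∑ m, S l m * pd i (pd m fun y => u y l) x) +
        ∑ l, ∑ n, ∑ m, R l m n * pd i (pd n (pd m fun y => u y l)) x := fun x hx => by
  rw [pd_congr hΩ (fun y hy => sum_strain_eq hΩ (hu.of_le (by norm_num)) hy hS hR) i x hx]
  have h₁ (l m : Fin 3) := contDiffOn_pd (m := 2) hΩ (contDiffOn_apply hu l) (by norm_num) m
  have h₂ (l n m : Fin 3) := contDiffOn_pd (m := 1) hΩ (h₁ l m) (by norm_num) n
  exact pd_lincomb (fun l m => differentiableAt_of_contDiffOn hΩ (h₁ l m) (by norm_num) hx)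
    (fun l n m => differentiableAt_of_contDiffOn hΩ (h₂ l n m) le_rfl hx) i

theorem pd_pd_sum_strain (hΩ : IsOpen Ω) (hu : ContDiffOn ℝ 4 u Ω) (hS : ∀ l m, S l m = S m l)
    (hR : ∀ l m n, R l m n = R m l n) (i j : Fin 3) : ∀ x ∈ Ω,
    pd i (pd j fun y => (∑ l, ∑ m, S l m * strain u l m y) +
        ∑ l, ∑ m, ∑ n, R l m n * pd n (strain u l m) y) x =
      (∑ l, ∑ m, S l m * pd i (pd j (pd m fun y => u y l)) x) +
        ∑ l, ∑ n, ∑ m, R l m n * pd i (pd j (pd n (pd m fun y => u y l))) x := fun x hx => by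
  rw [pd_congr hΩ (pd_sum_strain hΩ (hu.of_le (by norm_num)) hS hR j) i x hx]
  have h₁ (l m : Fin 3) := contDiffOn_pd (m := 3) hΩ (contDiffOn_apply hu l) (by norm_num) m
  have h₂ (l n m : Fin 3) := contDiffOn_pd (m := 2) hΩ (h₁ l m) (by norm_num) n
  have h₃ (l j n m : Fin 3) := contDiffOn_pd (m := 1) hΩ (h₂ l n m) (by norm_num) j
  exact pd_lincomb (fun l m => differentiableAt_of_contDiffOn hΩ (h₂ l j m) (by norm_num) hx)
    (fun l n m => differentiableAt_of_contDiffOn hΩ (h₃ l j n m) le_rfl hx) i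

end Stress

/-- The internal force for abstract constitutive tensors: `N` couples the strain to the hyperstress
and `A` the strain gradient to the hyperstress. -/
theorem force_eq_sum (hΩ : IsOpen Ω) (hu : ContDiffOn ℝ 4 u Ω) (hx : x ∈ Ω) {C : Tensor4}
    {M N : Tensor5} {A : Tensor6} (hC : ∀ i k l m, C i k l m = C i k m l)
    (hM : ∀ i k l m n, M i k l m n = M i k m l n) (hN : ∀ i j k l m, N i j k l m = N i j k m l)
    (hA : ∀ i j k l m n, A i j k l m n = A i j k m l n) (k : Fin 3) :
    (∑ i, pd i (fun y => (∑ l, ∑ m, C i k l m * strain u l m y) +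
        ∑ l, ∑ m, ∑ n, M i k l m n * pd n (strain u l m) y) x) -
      (∑ i, ∑ j, pd i (pd j fun y => (∑ l, ∑ m, N i j k l m * strain u l m y) +
        ∑ l, ∑ m, ∑ n, A i j k l m n * pd n (strain u l m) y) x) =
    ∑ l, ((∑ i, ∑ m, C i k l m * pd i (pd m fun y => u y l) x) +
      (∑ i, ∑ j, ∑ m, (M i k l m j - N i j k l m) * pd i (pd j (pd m fun y => u y l)) x) -
      ∑ i, ∑ j, ∑ n, ∑ m, A i j k l m n * pd i (pd j (pd n (pd m fun y => u y l))) x) := by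
  have h₁ (i : Fin 3) := pd_sum_strain hΩ (hu.of_le (by norm_num)) (hC i k) (hM i k) i x hx
  have h₂ (i j : Fin 3) := pd_pd_sum_strain hΩ hu (hN i j k) (hA i j k) i j x hx
  simp only [h₁, h₂, sub_mul, Finset.sum_add_distrib, Finset.sum_sub_distrib]
  have c₁ (F : Fin 3 → Fin 3 → ℝ) : ∑ l, ∑ i, F i l = ∑ i, ∑ l, F i l := Finset.sum_comm
  have c₂ (F : Fin 3 → Fin 3 → Fin 3 → ℝ) : ∑ l, ∑ i, ∑ j, F i j l = ∑ i, ∑ j, ∑ l, F i j l :=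
    Finset.sum_comm.trans (Finset.sum_congr rfl fun _ _ => Finset.sum_comm)
  rw [c₁ fun i l => ∑ m, C i k l m * pd i (pd m fun y => u y l) x,
    c₁ fun i l => ∑ j, ∑ m, M i k l m j * pd i (pd j (pd m fun y => u y l)) x,
    c₂ fun i j l => ∑ m, N i j k l m * pd i (pd j (pd m fun y => u y l)) x,
    c₂ fun i j l => ∑ n, ∑ m, A i j k l m n * pd i (pd j (pd n (pd m fun y => u y l))) x]
  ring

end ForceOperator

/-! ### Coordinate forms of the operators Δ, grad div and curl -/

section ForceFormula

variable {Ω : Set E3} {f : E3 → ℝ} {x : E3} {u : E3 → E3}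

theorem pd_pd_sum_mul (hΩ : IsOpen Ω) {ι : Type*} [Fintype ι] (c : ι → ℝ) {F : ι → E3 → ℝ}
    (hF : ∀ a, ContDiffOn ℝ 2 (F a) Ω) (hx : x ∈ Ω) (i j : Fin 3) :
    pd i (pd j fun y => ∑ a, c a * F a y) x = ∑ a, c a * pd i (pd j (F a)) x := by
  rw [pd_congr hΩ (fun y hy => pd_sum_mul c
    (fun a => differentiableAt_of_contDiffOn hΩ (hF a) (by norm_num) hy) j) i x hx]
  exact pd_sum_mul c (fun a => differentiableAt_of_contDiffOn hΩ
    (contDiffOn_pd (m := 1) hΩ (hF a) (by norm_num) j) le_rfl hx) i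

theorem pd_pd_sum (hΩ : IsOpen Ω) {ι : Type*} [Fintype ι] {F : ι → E3 → ℝ}
    (hF : ∀ a, ContDiffOn ℝ 2 (F a) Ω) (hx : x ∈ Ω) (i j : Fin 3) :
    pd i (pd j fun y => ∑ a, F a y) x = ∑ a, pd i (pd j (F a)) x := by
  simpa using pd_pd_sum_mul hΩ (fun _ => 1) hF hx i j

/-- Agreement on Ω alone matters: the coordinate formulas for Δu and grad div u, to which Δ is
applied again, are available only there. -/
theorem laplacian_apply_of_eqOn (hΩ : IsOpen Ω) {v : E3 → E3} {g : Fin 3 → E3 → ℝ}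
    (hv : ∀ y ∈ Ω, ∀ k, v y k = g k y) (hg : ∀ k, ContDiffOn ℝ 2 (g k) Ω) (hx : x ∈ Ω) (k : Fin 3) :
    (Δ v) x k = ∑ i, pd i (pd i (g k)) x := by
  have hc : ContDiffOn ℝ 2 v Ω :=
    contDiffOn_euclidean.2 fun k => (hg k).congr fun y hy => hv y hy k
  rw [laplacian_apply_apply (hc.contDiffAt (hΩ.mem_nhds hx)),
    laplacian_apply ((contDiffOn_apply hc k).contDiffAt (hΩ.mem_nhds hx))]
  exact Finset.sum_congr rfl fun i _ =>
    pd_congr hΩ (pd_congr hΩ (fun y hy => hv y hy k) i) i x hx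

theorem contDiffOn_pd_apply {n : WithTop ℕ∞} {m : WithTop ℕ∞} (hΩ : IsOpen Ω)
    (hu : ContDiffOn ℝ n u Ω) (h : m + 1 ≤ n) (i l : Fin 3) :
    ContDiffOn ℝ m (pd i fun y => u y l) Ω :=
  contDiffOn_pd hΩ (contDiffOn_apply hu l) h i

theorem laplacian_coord (hΩ : IsOpen Ω) (hu : ContDiffOn ℝ 2 u Ω) :
    ∀ x ∈ Ω, ∀ k, (Δ u) x k = ∑ i, pd i (pd i fun y => u y k) x := fun _ hx k =>
  laplacian_apply_of_eqOn hΩ (fun _ _ _ => rfl) (fun k => contDiffOn_apply hu k) hx k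

theorem gradient_divergence_coord (hΩ : IsOpen Ω) (hu : ContDiffOn ℝ 2 u Ω) :
    ∀ x ∈ Ω, ∀ k, (∇ (divergence u) x) k = ∑ l, pd k (pd l fun y => u y l) x := fun x hx k => by
  rw [gradient_apply]
  exact pd_sum (fun l => differentiableAt_of_contDiffOn hΩ
    (contDiffOn_pd_apply (m := 1) hΩ hu (by norm_num) l l) le_rfl hx) k

theorem contDiffOn_pd_pd_apply (hΩ : IsOpen Ω) (hu : ContDiffOn ℝ 4 u Ω) (i j l : Fin 3) :
    ContDiffOn ℝ 2 (pd i (pd j fun y => u y l)) Ω :=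
  contDiffOn_pd (n := 3) hΩ (contDiffOn_pd_apply hΩ hu (by norm_num) j l) (by norm_num) i

theorem bilaplacian_coord (hΩ : IsOpen Ω) (hu : ContDiffOn ℝ 4 u Ω) (hx : x ∈ Ω) (k : Fin 3) :
    (Δ (Δ u)) x k = ∑ i, ∑ j, pd i (pd i (pd j (pd j fun y => u y k))) x := by
  rw [laplacian_apply_of_eqOn hΩ (laplacian_coord hΩ (hu.of_le (by norm_num)))
    (fun k => ContDiffOn.sum fun i _ => contDiffOn_pd_pd_apply hΩ hu i i k) hx k]
  exact Finset.sum_congr rfl fun i _ =>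
    pd_pd_sum hΩ (fun j => contDiffOn_pd_pd_apply hΩ hu j j k) hx i i

theorem laplacian_gradient_divergence_coord (hΩ : IsOpen Ω) (hu : ContDiffOn ℝ 4 u Ω) (hx : x ∈ Ω)
    (k : Fin 3) : (Δ (∇ (divergence u))) x k =
      ∑ i, ∑ l, pd i (pd i (pd k (pd l fun y => u y l))) x := by
  rw [laplacian_apply_of_eqOn hΩ (gradient_divergence_coord hΩ (hu.of_le (by norm_num)))
    (fun k => ContDiffOn.sum fun l _ => contDiffOn_pd_pd_apply hΩ hu k l l) hx k]
  exact Finset.sum_congr rfl fun i _ =>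
    pd_pd_sum hΩ (fun l => contDiffOn_pd_pd_apply hΩ hu k l l) hx i i

/-- The order of the indices, with its minus sign, matches the symbol det(ξ, e_k, e_l) of the
coupling term. -/
theorem curl_apply (u : E3 → E3) (x : E3) (k : Fin 3) :
    curl u x k = ∑ p : Fin 3 × Fin 3, -levi p.2 k p.1 * pd p.2 (fun y => u y p.1) x := by
  have h : ∀ i : Fin 3, i = 0 ∨ i = 1 ∨ i = 2 := by decide
  simp only [Fintype.sum_prod_type, Fin.sum_univ_three, levi, curl]
  rcases h k with rfl | rfl | rfl <;> simp <;> ring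

theorem laplacian_curl_coord (hΩ : IsOpen Ω) (hu : ContDiffOn ℝ 3 u Ω) (hx : x ∈ Ω) (k : Fin 3) :
    (Δ (curl u)) x k =
      -∑ l, ∑ i, ∑ m, levi m k l * pd i (pd i (pd m fun y => u y l)) x := by
  have h₁ (p : Fin 3 × Fin 3) := contDiffOn_pd_apply (m := 2) hΩ hu (by norm_num) p.2 p.1
  rw [laplacian_apply_of_eqOn hΩ (fun y _ => curl_apply u y)
    (fun k => ContDiffOn.sum fun p _ => contDiffOn_const.mul (h₁ p)) hx k,
    Finset.sum_comm, ← Finset.sum_neg_distrib]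
  refine Finset.sum_congr rfl fun i _ => ?_
  rw [pd_pd_sum_mul hΩ _ h₁ hx i i, Fintype.sum_prod_type]
  simp

/-! ### The internal force of a rotation-invariant material -/

/-- The factor that relates the isotropic coupling tensor to the operator `Δ curl`. -/
noncomputable def couplingFactor : HyperstressContraction → ℝ
  | .freeLast => 1 / 2
  | .freeMiddle => -1

theorem couplingFactor_ne_zero (conv : HyperstressContraction) : couplingFactor conv ≠ 0 := by
  cases conv <;> norm_num [couplingFactor]

/-- The factor of `Δ Δ` in the internal force. -/
def transverseModulus (A : Tensor6) : HyperstressContraction → ℝ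
  | .freeLast => A 0 0 1 1 0 0
  | .freeMiddle => A 0 1 0 1 0 0

theorem mem_isotropicCouplingTensors {mat : Material} (h : mat ∈ rotationInvariantMaterials) :
    mat.M ∈ isotropicCouplingTensors :=
  ⟨mat.symmM, fun _ hQ => (h hQ).1.2⟩

/-- With `N` and `A` left abstract, both placements of the hyperstress index and classical
elasticity (`M = N = A = 0`) are instances. -/
theorem force_of_symbols (hΩ : IsOpen Ω) (hu : ContDiffOn ℝ 4 u Ω) (hx : x ∈ Ω) {C : Tensor4}
    {M N : Tensor5} {A : Tensor6} (hC : ∀ i k l m, C i k l m = C i k m l)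
    (hM : ∀ i k l m n, M i k l m n = M i k m l n) (hN : ∀ i j k l m, N i j k l m = N i j k m l)
    (hA : ∀ i j k l m n, A i j k l m n = A i j k m l n) (k : Fin 3) {c d g a b : ℝ}
    (sC : ∀ l (ξ : Fin 3 → ℝ), ∑ i, ∑ m, C i k l m * (ξ i * ξ m) =
      c * kron k l * (ξ ⬝ᵥ ξ) + d * (ξ k * ξ l))
    (sM : ∀ l (ξ : Fin 3 → ℝ), ∑ i, ∑ j, ∑ m, (M i k l m j - N i j k l m) * (ξ i * ξ j * ξ m) =
      g * ((ξ ⬝ᵥ ξ) * ∑ j, levi j k l * ξ j))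
    (sA : ∀ l (ξ : Fin 3 → ℝ), ∑ i, ∑ j, ∑ n, ∑ m, A i j k l m n * (ξ i * ξ j * ξ n * ξ m) =
      a * kron k l * (ξ ⬝ᵥ ξ) ^ 2 + b * ((ξ ⬝ᵥ ξ) * (ξ k * ξ l))) :
    (∑ i, pd i (fun y => (∑ l, ∑ m, C i k l m * strain u l m y) +
        ∑ l, ∑ m, ∑ n, M i k l m n * pd n (strain u l m) y) x) -
      (∑ i, ∑ j, pd i (pd j fun y => (∑ l, ∑ m, N i j k l m * strain u l m y) +
        ∑ l, ∑ m, ∑ n, A i j k l m n * pd n (strain u l m) y) x) =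
    c * (Δ u) x k + d * ∇ (divergence u) x k - a * (Δ (Δ u)) x k
      - b * (Δ (∇ (divergence u))) x k - g * (Δ (curl u)) x k := by
  have hl (l : Fin 3) := contDiffOn_apply hu l
  rw [force_eq_sum hΩ hu hx hC hM hN hA k,
    Finset.sum_congr rfl fun l _ => congrArg₂ (· - ·) (congrArg₂ (· + ·)
      (sum_pd2_of_symbol hΩ ((hl l).of_le (by norm_num)) hx _ (sC l))
      (sum_pd3_of_symbol hΩ ((hl l).of_le (by norm_num)) hx _ (sM l)))
      (sum_pd4_of_symbol hΩ (hl l) hx _ (sA l)),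
    laplacian_coord hΩ (hu.of_le (by norm_num)) x hx,
    gradient_divergence_coord hΩ (hu.of_le (by norm_num)) x hx, bilaplacian_coord hΩ hu hx,
    laplacian_gradient_divergence_coord hΩ hu hx, laplacian_curl_coord hΩ (hu.of_le (by norm_num)) hx,
    Finset.sum_comm (f := fun i l => pd i (pd i (pd k (pd l fun y => u y l))) x)]
  simp only [Finset.sum_sub_distrib, Finset.sum_add_distrib, ← Finset.mul_sum, mul_assoc]
  simp only [kron, ite_mul, one_mul, zero_mul, Finset.sum_ite_eq, Finset.mem_univ, if_true]
  ring

theorem internalForce_formula (conv : HyperstressContraction) {mat : Material}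
    (hmat : mat ∈ rotationInvariantMaterials) :
    ∀ Ω : Set E3, IsOpen Ω → ∀ u : E3 → E3, ContDiffOn ℝ 4 u Ω → ∀ x ∈ Ω,
      internalForce conv mat u x = mat.C 0 1 1 0 • (Δ u) x +
        (mat.C 0 0 0 0 - mat.C 0 1 1 0) • ∇ (divergence u) x
        - transverseModulus mat.A conv • (Δ (Δ u)) x
        - (mat.A 0 0 0 0 0 0 - transverseModulus mat.A conv) • (Δ (∇ (divergence u))) x
        + (2 * (couplingFactor conv * mat.M 0 1 0 2 0)) • (Δ (curl u)) x := by
  have hM := mem_isotropicCouplingTensors hmat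
  have hC := symbol_C fun _ hQ => (hmat hQ).2
  -- Symmetry in the last pair, needed to replace the strain by ∂_m u_l, follows from the major and
  -- the first minor symmetry.
  have hC' (i k l m : Fin 3) : mat.C i k l m = mat.C i k m l := by
    rw [mat.symmC.2, mat.symmC.1, mat.symmC.2]
  have hA' (i j k l m n : Fin 3) : mat.A i j k l m n = mat.A i j k m l n := by
    rw [mat.symmA.2, mat.symmA.1, mat.symmA.2]
  have hinv : SO3 ⊆ symmetryGroupA mat.A := fun _ hQ => (hmat hQ).1.1
  have hM₁ := mat.symmM.1
  cases conv with
  | freeLast =>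
    intro Ω hΩ u hu x hx
    ext k
    refine (force_of_symbols (N := fun i j k l m => mat.M l m i j k) (A := mat.A) hΩ hu hx hC'
      (fun i k l m n => mat.symmM.2 i k l m n) (fun i j k l m => hM₁ l m i j k)
      hA' k (hC k) (symbol_M hM k) (symbol_A hinv k)).trans ?_
    simp [couplingFactor, transverseModulus]
  | freeMiddle =>
    intro Ω hΩ u hu x hx
    ext k
    refine (force_of_symbols (N := fun i j k l m => mat.M l m i k j)
      (A := fun i j k l m n => mat.A i k j l m n) hΩ hu hx hC'
      (fun i k l m n => mat.symmM.2 i k l m n) (fun i j k l m => hM₁ l m i k j)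
      (fun i j k l m n => hA' i k j l m n) k (hC k) (symbol_M' hM k) (symbol_A' hinv k)).trans ?_
    simp [couplingFactor, transverseModulus]
    ring

end ForceFormula

section Universal

variable {Ω : Set E3} {f : E3 → ℝ} {x : E3} {u : E3 → E3}

/-! ### Universal displacements -/

theorem laplacian_eq_zero_of_eqOn_zero (hΩ : IsOpen Ω) {v : E3 → E3} (hv : ∀ y ∈ Ω, v y = 0)
    (hx : x ∈ Ω) : (Δ v) x = 0 := by
  have : v =ᶠ[nhds x] fun _ => 0 := Filter.eventuallyEq_of_mem (hΩ.mem_nhds hx) hv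
  rw [(InnerProductSpace.laplacian_congr_nhds this).self_of_nhds,
    InnerProductSpace.laplacian_const]
  rfl

/-- Third derivatives commute, so each Δ∂_m u_l equals ∂_m Δu_l, which is zero. -/
theorem laplacian_curl_eq_zero (hΩ : IsOpen Ω) (hu : ContDiffOn ℝ 4 u Ω)
    (h : ∀ x ∈ Ω, (Δ u) x = 0) (hx : x ∈ Ω) : (Δ (curl u)) x = 0 := by
  ext k
  rw [laplacian_curl_coord hΩ (hu.of_le (by norm_num)) hx]
  have h₀ (m l : Fin 3) : ∑ i, pd i (pd i (pd m fun y => u y l)) x = 0 := by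
    have hl : ContDiffOn ℝ 3 (fun y => u y l) Ω := (contDiffOn_apply hu l).of_le (by norm_num)
    have h₁ (i : Fin 3) : pd i (pd i (pd m fun y => u y l)) x =
        pd m (pd i (pd i fun y => u y l)) x :=
      pdList_perm (l₁ := [i, i, m]) (l₂ := [m, i, i]) hΩ
        (((List.Perm.swap m i []).cons i).trans (List.Perm.swap m i [i])) hl x hx
    have h₂ : ∀ y ∈ Ω, ∑ i, pd i (pd i fun y => u y l) y = 0 := fun y hy => by
      rw [← laplacian_coord hΩ (hu.of_le (by norm_num)) y hy, h y hy]; rfl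
    rw [Finset.sum_congr rfl fun i _ => h₁ i, ← pd_sum (fun i => differentiableAt_of_contDiffOn hΩ
      (contDiffOn_pd_pd_apply hΩ hu i i l) (by norm_num) hx), pd_congr hΩ h₂ m x hx, pd_const]
  simp only [Finset.sum_comm (s := Finset.univ (α := Fin 3)) (f := fun i m => levi m k _ * _)]
  simp only [← Finset.mul_sum, h₀]
  simp

theorem isUniversal_of_laplacian_eq_zero (conv : HyperstressContraction) (hΩ : IsOpen Ω)
    (hu : ContDiffOn ℝ 4 u Ω) (h : ∀ x ∈ Ω, (Δ u) x = 0 ∧ ∇ (divergence u) x = 0) :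
    IsUniversal conv rotationInvariantMaterials Ω u := fun mat hmat x hx => by
  rw [internalForce_formula conv hmat Ω hΩ u hu x hx, (h x hx).1, (h x hx).2,
    laplacian_eq_zero_of_eqOn_zero hΩ (fun y hy => (h y hy).1) hx,
    laplacian_eq_zero_of_eqOn_zero hΩ (fun y hy => (h y hy).2) hx,
    laplacian_curl_eq_zero hΩ hu (fun y hy => (h y hy).1) hx]
  simp

theorem classSO3_subset : classSO3 ⊆ rotationInvariantMaterials := fun mat h =>
  (show mat.symmetryGroup = SO3 from h).ge

/-- A chiral isotropic material without strain-gradient stiffness. -/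
noncomputable def chiralMaterial (lam mu : ℝ) : Material where
  C := lameTensor lam mu
  M := chiralTensor
  A := 0
  symmC := lameTensor_symm lam mu
  symmM := chiralTensor_symm
  symmA := ⟨fun _ _ _ _ _ _ => rfl, fun _ _ _ _ _ _ => rfl⟩

/-- `C` and `A` are invariant under all of `O(3)`, so only the coupling decides: Q multiplies it by
det Q, and its nonzero component forces det Q = 1. -/
theorem chiralMaterial_mem (lam mu : ℝ) : chiralMaterial lam mu ∈ classSO3 := by
  refine Set.ext fun Q => ⟨fun h => ?_, fun hQ => ⟨⟨⟨SO3_subset_O3 hQ, ?_⟩, chiralTensor_mem.2 hQ⟩,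
    ⟨SO3_subset_O3 hQ, rotate4_lameTensor (SO3_subset_O3 hQ) lam mu⟩⟩⟩
  · refine mem_SO3_iff.2 ⟨h.2.1, ?_⟩
    have h₁ : rotate5 Q chiralTensor = chiralTensor := h.1.2.2
    rw [rotate5_chiralTensor h.2.1] at h₁
    simpa [chiralTensor_apply] using congrArg (fun T : Tensor5 => T 0 1 0 2 0) h₁
  · funext i j k l m n
    simp [rotate6, chiralMaterial]

theorem lameTensor_shear (lam mu : ℝ) : lameTensor lam mu 0 1 1 0 = mu := by
  simp [lameTensor, kron]

theorem lameTensor_sub (lam mu : ℝ) :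
    lameTensor lam mu 0 0 0 0 - lameTensor lam mu 0 1 1 0 = lam + mu := by
  simp [lameTensor, kron]
  ring

theorem laplacian_eq_zero_of_isUniversal (conv : HyperstressContraction) (hΩ : IsOpen Ω)
    (hu : ContDiffOn ℝ 4 u Ω) (h : IsUniversal conv classSO3 Ω u) :
    ∀ x ∈ Ω, (Δ u) x = 0 ∧ ∇ (divergence u) x = 0 := fun x hx => by
  have key (lam mu : ℝ) : mu • (Δ u) x + (lam + mu) • ∇ (divergence u) x +
      (2 * (couplingFactor conv * 1)) • (Δ (curl u)) x = 0 := by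
    have hf := internalForce_formula conv (classSO3_subset (chiralMaterial_mem lam mu)) Ω hΩ u hu x hx
    rw [h _ (chiralMaterial_mem lam mu) x hx] at hf
    have hA : transverseModulus (chiralMaterial lam mu).A conv = 0 := by cases conv <;> rfl
    rw [hA, show (chiralMaterial lam mu).C = lameTensor lam mu from rfl,
      show (chiralMaterial lam mu).M = chiralTensor from rfl,
      show (chiralMaterial lam mu).A = 0 from rfl, chiralTensor_apply, lameTensor_sub,
      lameTensor_shear] at hf
    simpa using hf.symm
  -- Vanishing Lamé constants isolate Δ curl u. Then (λ, μ) = (−1, 1) cancels grad div u and leaves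
  -- Δu, while (1, 0) leaves grad div u.
  have h₀ := key 0 0
  simp only [zero_smul, zero_add, add_zero, mul_one] at h₀
  constructor
  · simpa [h₀] using key (-1) 1
  · simpa [h₀] using key 1 0

theorem classical_force_formula (hΩ : IsOpen Ω) (hu : ContDiffOn ℝ 4 u Ω) (hx : x ∈ Ω)
    {C : Tensor4} (hC : HasSymmetriesC C) (hinv : SO3 ⊆ symmetryGroupC C) (k : Fin 3) :
    ∑ i, pd i (fun y => ∑ l, ∑ m, C i k l m * strain u l m y) x =
      C 0 1 1 0 * (Δ u) x k + (C 0 0 0 0 - C 0 1 1 0) * ∇ (divergence u) x k := by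
  have h := force_of_symbols (M := 0) (N := 0) (A := 0) hΩ hu hx
    (fun i k l m => by rw [hC.2, hC.1, hC.2]) (fun _ _ _ _ _ => rfl) (fun _ _ _ _ _ => rfl)
    (fun _ _ _ _ _ _ => rfl) k (symbol_C hinv k) (g := 0) (a := 0) (b := 0) (by simp) (by simp)
  have h₀ (i j : Fin 3) : pd i (pd j fun _ => 0) x = 0 := by
    rw [show pd j (fun _ => 0) = fun _ => 0 from funext fun _ => pd_const 0 j, pd_const]
  simpa [h₀] using h

theorem isClassicalIsotropicUniversal_iff (hΩ : IsOpen Ω) (hu : ContDiffOn ℝ 4 u Ω) :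
    IsClassicalIsotropicUniversal Ω u ↔ ∀ x ∈ Ω, (Δ u) x = 0 ∧ ∇ (divergence u) x = 0 := by
  refine ⟨fun h x hx => ?_, fun h C hC hinv x hx k => ?_⟩
  · have key (lam mu : ℝ) (k : Fin 3) :
        mu * (Δ u) x k + (lam + mu) * ∇ (divergence u) x k = 0 := by
      rw [← h _ (lameTensor_symm lam mu) (symmetryGroupC_lameTensor lam mu) x hx k,
        classical_force_formula hΩ hu hx (lameTensor_symm lam mu)
          (by rw [symmetryGroupC_lameTensor]; exact SO3_subset_O3), lameTensor_sub, lameTensor_shear]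
    constructor <;> ext k
    · simpa using key (-1) 1 k
    · simpa using key 1 0 k
  · rw [classical_force_formula hΩ hu hx hC (hinv ▸ SO3_subset_O3), (h x hx).1, (h x hx).2]
    simp

end Universal

section RadialIntegrals

/-! ### Radial integrals on star-shaped sets -/

section Radial

open MeasureTheory

variable {F : Type} [NormedAddCommGroup F] [NormedSpace ℝ F] {U : Set E3} {x₀ x : E3} {g : E3 → F}

/-- The point at parameter `t` of the segment from `x₀` to `x`. -/
def ray (x₀ x : E3) (t : ℝ) : E3 := x₀ + t • (x - x₀)

/-- The weighted mean of `g` over the segment from `x₀` to `x`. -/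
noncomputable def radialIntegral (x₀ : E3) (k : ℕ) (g : E3 → F) (x : E3) : F :=
  ∫ t in (0 : ℝ)..1, t ^ k • g (ray x₀ x t)

theorem ray_mem (hU : StarConvex ℝ x₀ U) (hx : x ∈ U) {t : ℝ} (ht : t ∈ Set.Icc (0 : ℝ) 1) :
    ray x₀ x t ∈ U := by
  have := hU hx (a := 1 - t) (b := t) (by linarith [ht.2]) ht.1 (by ring)
  convert this using 1
  simp only [ray]
  module

theorem continuous_ray (x₀ : E3) : Continuous fun p : E3 × ℝ => ray x₀ p.1 p.2 := by
  unfold ray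
  fun_prop

theorem continuousOn_smul_ray (hU : StarConvex ℝ x₀ U) (hg : ContinuousOn g U) (k : ℕ)
    (hx : x ∈ U) : ContinuousOn (fun t : ℝ => t ^ k • g (ray x₀ x t)) (Set.Icc 0 1) := by
  have h : ContinuousOn (fun t : ℝ => ray x₀ x t) (Set.Icc 0 1) :=
    ((continuous_ray x₀).comp (Continuous.prodMk_right x)).continuousOn
  exact (continuous_pow k).continuousOn.smul (hg.comp h fun t ht => ray_mem hU hx ht)

theorem intervalIntegrable_smul_ray (hU : StarConvex ℝ x₀ U) (hg : ContinuousOn g U) (k : ℕ)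
    (hx : x ∈ U) : IntervalIntegrable (fun t : ℝ => t ^ k • g (ray x₀ x t)) volume 0 1 :=
  ContinuousOn.intervalIntegrable (by
    rw [Set.uIcc_of_le zero_le_one]; exact continuousOn_smul_ray hU hg k hx)

/-- Compactness of a closed ball times [0, 1] gives the constant dominating function for continuity
and differentiation under the integral. -/
theorem exists_bound_smul_ray (hUo : IsOpen U) (hU : StarConvex ℝ x₀ U) (hg : ContinuousOn g U)
    (k : ℕ) (hx : x ∈ U) : ∃ s ∈ nhds x, s ⊆ U ∧ ∃ K : ℝ, ∀ y ∈ s, ∀ t ∈ Set.Icc (0 : ℝ) 1,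
      ‖t ^ k • g (ray x₀ y t)‖ ≤ K := by
  obtain ⟨ε, hε, hs⟩ := Metric.nhds_basis_closedBall.mem_iff.1 (hUo.mem_nhds hx)
  have hc : IsCompact (Metric.closedBall x ε ×ˢ Set.Icc (0 : ℝ) 1) :=
    (isCompact_closedBall x ε).prod isCompact_Icc
  have hcont : ContinuousOn (fun p : E3 × ℝ => p.2 ^ k • g (ray x₀ p.1 p.2))
      (Metric.closedBall x ε ×ˢ Set.Icc (0 : ℝ) 1) :=
    (continuous_snd.pow k).continuousOn.smul (hg.comp (continuous_ray x₀).continuousOn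
      fun p hp => ray_mem hU (hs hp.1) hp.2)
  obtain ⟨K, hK⟩ := hc.exists_bound_of_continuousOn hcont
  exact ⟨_, Metric.closedBall_mem_nhds x hε, hs, K, fun y hy t ht => hK (y, t) ⟨hy, ht⟩⟩

theorem aestronglyMeasurable_smul_ray (hU : StarConvex ℝ x₀ U) (hg : ContinuousOn g U) (k : ℕ)
    (hx : x ∈ U) : AEStronglyMeasurable (fun t : ℝ => t ^ k • g (ray x₀ x t))
      (volume.restrict (Set.uIoc 0 1)) :=
  (intervalIntegrable_iff.1 (intervalIntegrable_smul_ray hU hg k hx)).aestronglyMeasurable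

theorem uIoc_subset_Icc {t : ℝ} (ht : t ∈ Set.uIoc (0 : ℝ) 1) : t ∈ Set.Icc (0 : ℝ) 1 := by
  rw [Set.uIoc_of_le zero_le_one] at ht
  exact Set.Ioc_subset_Icc_self ht

theorem continuousOn_radialIntegral (hUo : IsOpen U) (hU : StarConvex ℝ x₀ U)
    (hg : ContinuousOn g U) (k : ℕ) : ContinuousOn (radialIntegral x₀ k g) U := fun x hx => by
  obtain ⟨s, hs, hsU, K, hK⟩ := exists_bound_smul_ray hUo hU hg k hx
  refine ContinuousAt.continuousWithinAt ?_
  refine intervalIntegral.continuousAt_of_dominated_interval (bound := fun _ => K)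
    (Filter.eventually_of_mem hs fun y hy => aestronglyMeasurable_smul_ray hU hg k (hsU hy))
    (Filter.eventually_of_mem hs fun y hy => Filter.Eventually.of_forall fun t ht =>
      hK y hy t (uIoc_subset_Icc ht)) intervalIntegrable_const
    (Filter.Eventually.of_forall fun t ht => ?_)
  have h₁ : ContinuousAt g (ray x₀ x t) :=
    hg.continuousAt (hUo.mem_nhds (ray_mem hU hx (uIoc_subset_Icc ht)))
  have h₂ : ContinuousAt (fun y => ray x₀ y t) x :=
    ((continuous_ray x₀).comp (Continuous.prodMk_left t)).continuousAt
  exact (ContinuousAt.comp (f := fun y => ray x₀ y t) h₁ h₂).const_smul (t ^ k)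

/-- The chain rule along the ray brings out a factor t, so the derivative is again a radial
integral, with weight raised by one. -/
theorem hasFDerivAt_radialIntegral (hUo : IsOpen U) (hU : StarConvex ℝ x₀ U)
    (hg : ContDiffOn ℝ 1 g U) (k : ℕ) (hx : x ∈ U) :
    HasFDerivAt (radialIntegral x₀ k g) (radialIntegral x₀ (k + 1) (fderiv ℝ g) x) x := by
  have hg' : ContinuousOn (fderiv ℝ g) U := hg.continuousOn_fderiv_of_isOpen hUo le_rfl
  obtain ⟨s, hs, hsU, K, hK⟩ := exists_bound_smul_ray hUo hU hg' (k + 1) hx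
  refine intervalIntegral.hasFDerivAt_integral_of_dominated_of_fderiv_le (bound := fun _ => K) hs
    (F' := fun y t => t ^ (k + 1) • fderiv ℝ g (ray x₀ y t))
    (Filter.eventually_of_mem hs fun y hy =>
      aestronglyMeasurable_smul_ray hU hg.continuousOn k (hsU hy))
    (intervalIntegrable_smul_ray hU hg.continuousOn k hx)
    (aestronglyMeasurable_smul_ray hU hg' (k + 1) hx)
    (Filter.Eventually.of_forall fun t ht y hy => hK y hy t (uIoc_subset_Icc ht))
    intervalIntegrable_const (Filter.Eventually.of_forall fun t ht y hy => ?_)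
  have h₁ : HasFDerivAt g (fderiv ℝ g (ray x₀ y t)) (ray x₀ y t) :=
    ((hg.differentiableOn one_ne_zero).differentiableAt
      (hUo.mem_nhds (ray_mem hU (hsU hy) (uIoc_subset_Icc ht)))).hasFDerivAt
  have h₂ : HasFDerivAt (fun z => ray x₀ z t) (t • ContinuousLinearMap.id ℝ E3) y :=
    (((hasFDerivAt_id y).sub_const x₀).const_smul t).const_add x₀
  refine ((h₁.comp y h₂).const_smul (t ^ k)).congr_fderiv ?_
  ext v
  simp [pow_succ, mul_smul]

/-- The induction must vary the target space and the weight, since the derivative takes values in a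
space of linear maps and has weight k + 1. -/
theorem contDiffOn_radialIntegral_nat (hUo : IsOpen U) (hU : StarConvex ℝ x₀ U) (n : ℕ) :
    ∀ {F : Type} [NormedAddCommGroup F] [NormedSpace ℝ F] {g : E3 → F} (k : ℕ),
      ContDiffOn ℝ n g U → ContDiffOn ℝ n (radialIntegral x₀ k g) U := by
  induction n with
  | zero =>
    intro F _ _ g k hg
    simp only [Nat.cast_zero, contDiffOn_zero] at hg ⊢
    exact continuousOn_radialIntegral hUo hU hg k
  | succ n ih =>
    intro F _ _ g k hg
    have hd (x : E3) (hx : x ∈ U) := hasFDerivAt_radialIntegral hUo hU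
      (hg.of_le (by norm_cast; omega)) k hx
    push_cast at hg ⊢
    rw [contDiffOn_succ_iff_fderiv_of_isOpen hUo]
    refine ⟨fun x hx => (hd x hx).differentiableAt.differentiableWithinAt, by simp, ?_⟩
    refine (ih (k + 1) ((contDiffOn_succ_iff_fderiv_of_isOpen hUo).1 hg).2.2).congr fun x hx => ?_
    exact (hd x hx).fderiv

theorem contDiffOn_radialIntegral (hUo : IsOpen U) (hU : StarConvex ℝ x₀ U) {r : ℕ∞}
    (hg : ContDiffOn ℝ r g U) (k : ℕ) : ContDiffOn ℝ r (radialIntegral x₀ k g) U :=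
  contDiffOn_iff_forall_nat_le.2 fun n hn =>
    contDiffOn_radialIntegral_nat hUo hU n k (hg.of_le (by exact_mod_cast hn))

theorem fderiv_radialIntegral_apply (hUo : IsOpen U) (hU : StarConvex ℝ x₀ U) [CompleteSpace F]
    (hg : ContDiffOn ℝ 1 g U) (k : ℕ) (hx : x ∈ U) (v : E3) :
    fderiv ℝ (radialIntegral x₀ k g) x v =
      radialIntegral x₀ (k + 1) (fun y => fderiv ℝ g y v) x := by
  rw [(hasFDerivAt_radialIntegral hUo hU hg k hx).fderiv, radialIntegral, radialIntegral]
  rw [ContinuousLinearMap.intervalIntegral_apply (intervalIntegrable_smul_ray hU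
    (hg.continuousOn_fderiv_of_isOpen hUo le_rfl) (k + 1) hx)]
  rfl

/-- Euler's relation for the radial integral. -/
theorem radialIntegral_euler (hUo : IsOpen U) (hU : StarConvex ℝ x₀ U) {f : E3 → ℝ}
    (hf : ContDiffOn ℝ 1 f U) (hx : x ∈ U) :
    fderiv ℝ (radialIntegral x₀ 1 f) x (x - x₀) + 2 * radialIntegral x₀ 1 f x = f x := by
  have hc : ContinuousOn (fun y => fderiv ℝ f y (x - x₀)) U :=
    (hf.continuousOn_fderiv_of_isOpen hUo le_rfl).clm_apply continuousOn_const
  have hi₁ := intervalIntegrable_smul_ray hU hc 2 hx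
  have hi₂ := (intervalIntegrable_smul_ray hU hf.continuousOn 1 hx).const_mul 2
  rw [fderiv_radialIntegral_apply hUo hU hf 1 hx, radialIntegral, radialIntegral,
    ← intervalIntegral.integral_const_mul, ← intervalIntegral.integral_add hi₁ hi₂]
  -- The integrand is the derivative of t² f along the ray, whose boundary term at t = 0 vanishes.
  have hd : ∀ t ∈ Set.uIcc (0 : ℝ) 1, HasDerivAt (fun t => t ^ 2 * f (ray x₀ x t))
      (t ^ 2 • fderiv ℝ f (ray x₀ x t) (x - x₀) + 2 * (t ^ 1 • f (ray x₀ x t))) t := by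
    intro t ht
    rw [Set.uIcc_of_le zero_le_one] at ht
    have h₁ : HasFDerivAt f (fderiv ℝ f (ray x₀ x t)) (ray x₀ x t) :=
      ((hf.differentiableOn one_ne_zero).differentiableAt
        (hUo.mem_nhds (ray_mem hU hx ht))).hasFDerivAt
    have h₂ : HasDerivAt (ray x₀ x) (x - x₀) t :=
      (((hasDerivAt_id t).smul_const (x - x₀)).const_add x₀).congr_deriv (one_smul ℝ _)
    have := (hasDerivAt_pow 2 t).mul (h₁.comp_hasDerivAt t h₂)
    refine this.congr_deriv ?_
    simp
    ring
  rw [intervalIntegral.integral_eq_sub_of_hasDerivAt hd (hi₁.add hi₂)]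
  simp [ray]

end Radial

end RadialIntegrals

section Potentials

/-! ### Divergence-free fields and antisymmetric potentials -/

variable {U : Set E3} {x₀ x : E3} {r : ℕ∞}

theorem four_le_coe (hr : 4 ≤ r) : (4 : WithTop ℕ∞) ≤ r := WithTop.coe_le_coe.2 hr

theorem pd_neg (f : E3 → ℝ) (i : Fin 3) : pd i (fun y => -f y) = fun y => -pd i f y := by
  funext y
  simp only [pd, fderiv_fun_neg, neg_apply]

theorem pd_mul {f g : E3 → ℝ} (hf : DifferentiableAt ℝ f x) (hg : DifferentiableAt ℝ g x)
    (i : Fin 3) : pd i (fun y => f y * g y) x = pd i f x * g x + f x * pd i g x := by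
  simp only [pd, fderiv_fun_mul hf hg, add_apply, smul_apply, smul_eq_mul]
  ring

theorem pd_affine (F : E3 →L[ℝ] E3) (b : E3) (i k : Fin 3) :
    pd i (fun y => (F y + b) k) = fun _ => F (EuclideanSpace.single i 1) k := by
  funext y
  have : HasFDerivAt (fun y => (F y + b) k)
      ((EuclideanSpace.proj k : E3 →L[ℝ] ℝ).comp F) y :=
    (EuclideanSpace.proj k : E3 →L[ℝ] ℝ).hasFDerivAt.comp y
      (F.hasFDerivAt.add_const b)
  rw [pd, this.fderiv]
  rfl

theorem pd_coord_sub (x₀ : E3) (i j : Fin 3) : pd j (fun y => y i - x₀ i) x = kron i j := by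
  have := congrFun (pd_affine (ContinuousLinearMap.id ℝ E3) (-x₀) j i) x
  simpa [kron, sub_eq_add_neg] using this

theorem contDiffOn_div_potential {W : Fin 3 → Fin 3 → E3 → ℝ} {w : E3 → E3} {n m : WithTop ℕ∞}
    (hU : IsOpen U) (hW : ∀ i j, ContDiffOn ℝ n (W i j) U) (hmn : m + 1 ≤ n)
    (hw : ∀ x ∈ U, ∀ i, w x i = ∑ j, pd j (W i j) x) : ContDiffOn ℝ m w U :=
  contDiffOn_euclidean.2 fun i => (ContDiffOn.sum fun j _ =>
    contDiffOn_pd hU (hW i j) hmn j).congr fun x hx => hw x hx i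

theorem laplacian_div_potential {W : Fin 3 → Fin 3 → E3 → ℝ} {w : E3 → E3} (hU : IsOpen U)
    (hW : ∀ i j, ContDiffOn ℝ 3 (W i j) U) (hw : ∀ x ∈ U, ∀ i, w x i = ∑ j, pd j (W i j) x)
    (hx : x ∈ U) (i : Fin 3) : (Δ w) x i = ∑ j, pd j (Δ (W i j)) x := by
  have h₁ (i j : Fin 3) := contDiffOn_pd (m := 2) hU (hW i j) (by norm_num) j
  have h₂ (i j k : Fin 3) : ContDiffOn ℝ 1 (pd k (pd k (W i j))) U :=
    contDiffOn_pd hU (contDiffOn_pd (m := 2) hU (hW i j) (by norm_num) k) (by norm_num) k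
  rw [laplacian_apply_of_eqOn hU hw (fun i => ContDiffOn.sum fun j _ => h₁ i j) hx i,
    Finset.sum_congr rfl fun k _ => pd_pd_sum hU (h₁ i) hx k k, Finset.sum_comm]
  refine Finset.sum_congr rfl fun j _ => ?_
  rw [pd_congr hU (fun y hy => laplacian_apply
    (((hW i j).contDiffAt (hU.mem_nhds hy)).of_le (by norm_num))) j x hx,
    pd_sum fun k => differentiableAt_of_contDiffOn hU (h₂ i j k) le_rfl hx]
  exact Finset.sum_congr rfl fun k _ => pdList_perm (l₁ := [k, k, j]) (l₂ := [j, k, k]) hU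
    (((List.Perm.swap j k []).cons k).trans (List.Perm.swap j k [k])) (hW i j) x hx

theorem divergence_div_potential {W : Fin 3 → Fin 3 → E3 → ℝ} {w : E3 → E3} (hU : IsOpen U)
    (hW : ∀ i j, ContDiffOn ℝ 2 (W i j) U) (ha : ∀ x ∈ U, ∀ i j, W i j x = -W j i x)
    (hw : ∀ x ∈ U, ∀ i, w x i = ∑ j, pd j (W i j) x) (hx : x ∈ U) : divergence w x = 0 := by
  have h₁ : divergence w x = ∑ i, ∑ j, pd i (pd j (W i j)) x :=
    Finset.sum_congr rfl fun i _ => by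
      rw [pd_congr hU (fun y hy => hw y hy i) i x hx]
      exact pd_sum (fun j => differentiableAt_of_contDiffOn hU
        (contDiffOn_pd (m := 1) hU (hW i j) (by norm_num) j) le_rfl hx) i
  have h₂ : ∑ i, ∑ j, pd i (pd j (W i j)) x = -∑ i, ∑ j, pd i (pd j (W i j)) x := by
    conv_rhs => rw [Finset.sum_comm]
    simp only [← Finset.sum_neg_distrib]
    refine Finset.sum_congr rfl fun i _ => Finset.sum_congr rfl fun j _ => ?_
    rw [pd_congr hU (pd_congr hU (fun y hy => ha y hy i j) j) i x hx, pd_neg, pd_neg]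
    exact congrArg Neg.neg (pd_comm hU (hW j i) i j x hx)
  rw [h₁]
  linarith

/-- Poincaré lemma with W_ij = g_i y_j − g_j y_i, where y = x − x₀ and g is the radial integral of v
with weight t. Since div g = 0, ∂_j W_ij = y·∇g_i + 3g_i − g_i, which is v_i by Euler's relation. -/
theorem exists_potential_of_divergence_eq_zero (hUo : IsOpen U) (hU : StarConvex ℝ x₀ U)
    (hr : 1 ≤ r) {v : E3 → E3} (hv : ContDiffOn ℝ r v U) (hdiv : ∀ x ∈ U, divergence v x = 0) :
    ∃ W : Fin 3 → Fin 3 → E3 → ℝ, (∀ i j, ContDiffOn ℝ r (W i j) U) ∧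
      (∀ x i j, W i j x = -W j i x) ∧ ∀ x ∈ U, ∀ i, v x i = ∑ j, pd j (W i j) x := by
  have hr' : (1 : WithTop ℕ∞) ≤ r := by exact_mod_cast hr
  have hvi (i : Fin 3) := contDiffOn_apply hv i
  set g : Fin 3 → E3 → ℝ := fun i => radialIntegral x₀ 1 fun y => v y i with hg
  have hgr (i : Fin 3) : ContDiffOn ℝ r (g i) U := contDiffOn_radialIntegral hUo hU (hvi i) 1
  have hcoord (i : Fin 3) : ContDiff ℝ r fun y : E3 => y i - x₀ i := by fun_prop
  refine ⟨fun i j y => g i y * (y j - x₀ j) - g j y * (y i - x₀ i), fun i j =>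
    ((hgr i).mul (hcoord j).contDiffOn).sub ((hgr j).mul (hcoord i).contDiffOn),
    fun x i j => by ring, fun x hx i => ?_⟩
  have hgd (i : Fin 3) : DifferentiableAt ℝ (g i) x := differentiableAt_of_contDiffOn hUo (hgr i) hr' hx
  have hcd (i : Fin 3) : DifferentiableAt ℝ (fun y : E3 => y i - x₀ i) x :=
    ((hcoord i).of_le hr').differentiable one_ne_zero x
  have hpd (j : Fin 3) : pd j (fun y => g i y * (y j - x₀ j) - g j y * (y i - x₀ i)) x =
      pd j (g i) x * (x j - x₀ j) + g i x * kron j j -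
        (pd j (g j) x * (x i - x₀ i) + g j x * kron i j) := by
    rw [pd_sub ((hgd i).fun_mul (hcd j)) ((hgd j).fun_mul (hcd i)), pd_mul (hgd i) (hcd j),
      pd_mul (hgd j) (hcd i), pd_coord_sub, pd_coord_sub]
  have hv1 (j : Fin 3) : ContDiffOn ℝ 1 (fun y => v y j) U := (hvi j).of_le hr'
  -- The divergence passes under the integral: div g is the radial integral of div v with weight t².
  have hdg : ∑ j, pd j (g j) x = 0 := by
    simp only [pd, hg, fderiv_radialIntegral_apply hUo hU (hv1 _) 1 hx]
    simp only [radialIntegral]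
    rw [← intervalIntegral.integral_finsetSum fun j _ => intervalIntegrable_smul_ray hU
      (((hv1 j).continuousOn_fderiv_of_isOpen hUo le_rfl).clm_apply continuousOn_const) (1 + 1) hx]
    rw [intervalIntegral.integral_congr (g := fun _ => 0), intervalIntegral.integral_zero]
    intro t ht
    rw [Set.uIcc_of_le zero_le_one] at ht
    have := hdiv _ (ray_mem hU hx ht)
    simp only [divergence, pd] at this
    simp only [← Finset.smul_sum, this, smul_zero]
  have heuler := radialIntegral_euler hUo hU (hv1 i) hx
  have hlin : fderiv ℝ (g i) x (x - x₀) = ∑ j, pd j (g i) x * (x j - x₀ j) := by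
    have hx' : x - x₀ = ∑ j, (x j - x₀ j) • EuclideanSpace.single j (1 : ℝ) := by
      ext k
      simp [Pi.single_apply]
    conv_lhs => rw [hx', map_sum]
    exact Finset.sum_congr rfl fun j _ => by rw [map_smul, smul_eq_mul, mul_comm]; rfl
  simp only [hpd, Finset.sum_sub_distrib, Finset.sum_add_distrib, ← Finset.sum_mul, hdg, ← hlin]
  rw [← heuler]
  simp [kron]
  ring

/-- Any antisymmetric potential serves: with S = ΔW the source condition reads Δv = 0. -/
theorem isDivOfPoissonPotential_of_laplacian_eq_zero (hUo : IsOpen U) (hU : StarConvex ℝ x₀ U)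
    (hr : 4 ≤ r) {v : E3 → E3} (hv : ContDiffOn ℝ r v U) (hdiv : ∀ x ∈ U, divergence v x = 0)
    (hlap : ∀ x ∈ U, (Δ v) x = 0) : IsDivOfPoissonPotential r U v := by
  obtain ⟨W, hW, ha, hw⟩ := exists_potential_of_divergence_eq_zero hUo hU
    (le_trans (by norm_num) hr) hv hdiv
  refine ⟨W, fun i j => Δ (W i j), hW, fun x _ => ha x, fun _ _ _ _ => rfl, fun x hx i => ?_, hw⟩
  have h3 : (3 : WithTop ℕ∞) ≤ r := le_trans (by norm_num) (four_le_coe hr)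
  rw [← laplacian_div_potential hUo (fun i j => (hW i j).of_le h3) hw hx i, hlap x hx]
  rfl

theorem laplacian_eq_zero_of_hasRepresentation (hU : IsOpen U) (hr : 4 ≤ r) {u : E3 → E3}
    (h : HasRepresentation r U u) : ∀ x ∈ U, (Δ u) x = 0 ∧ ∇ (divergence u) x = 0 := by
  intro x hx
  obtain ⟨F, b, w, ⟨W, S, hW, ha, hS, hdS, hw⟩, hu⟩ := h
  have h4 : (4 : WithTop ℕ∞) ≤ r := four_le_coe hr
  have h3 : (3 : WithTop ℕ∞) ≤ r := le_trans (by norm_num) h4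
  have hw2 : ContDiffOn ℝ 2 w U :=
    contDiffOn_div_potential hU (fun i j => (hW i j).of_le h3) (by norm_num) hw
  have hl : ContDiff ℝ 2 fun y => F y + b := F.contDiff.add contDiff_const
  have hu' : u =ᶠ[nhds x] (fun y => F y + b) + w := Filter.eventuallyEq_of_mem (hU.mem_nhds hx) hu
  constructor
  · rw [(InnerProductSpace.laplacian_congr_nhds hu').self_of_nhds,
      hl.contDiffAt.laplacian_add (hw2.contDiffAt (hU.mem_nhds hx))]
    ext i
    have h₁ : (Δ fun y => F y + b) x i = 0 := by
      rw [laplacian_coord isOpen_univ hl.contDiffOn x trivial]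
      simp only [pd_affine, pd_const, Finset.sum_const_zero]
    have h₂ : (Δ w) x i = 0 := by
      rw [laplacian_div_potential hU (fun i j => (hW i j).of_le h3) hw hx, ← hdS x hx i]
      exact Finset.sum_congr rfl fun j _ => pd_congr hU (fun y hy => hS y hy i j) j x hx
    rw [PiLp.add_apply, h₁, h₂, add_zero]
    rfl
  · have hdiv : ∀ y ∈ U, divergence u y = ∑ i, F (EuclideanSpace.single i 1) i := fun y hy => by
      have h₁ := divergence_div_potential hU (fun i j => (hW i j).of_le (le_trans (by norm_num) h3))
        ha hw hy
      have h₂ (i : Fin 3) : pd i (fun z => u z i) y =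
          F (EuclideanSpace.single i 1) i + pd i (fun z => w z i) y := by
        rw [pd_congr hU (fun z hz => congrArg (fun v : E3 => v i) (hu z hz)) i y hy]
        have := pd_add (f := fun z => (F z + b) i) (g := fun z => w z i) (x := y)
          (differentiableAt_of_contDiffOn isOpen_univ (contDiffOn_apply hl.contDiffOn i)
            (by norm_num) trivial)
          (differentiableAt_of_contDiffOn hU (contDiffOn_apply hw2 i) (by norm_num) hy) i
        rw [pd_affine] at this
        exact this
      rw [divergence, Finset.sum_congr rfl fun i _ => h₂ i, Finset.sum_add_distrib]
      rw [divergence] at h₁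
      rw [h₁, add_zero]
    ext k
    rw [gradient_apply, pd_congr hU hdiv k x hx, pd_const]
    rfl

theorem hasSpecialRepresentation_of_laplacian_eq_zero (hUo : IsOpen U) (hU : StarConvex ℝ x₀ U)
    (hr : 4 ≤ r) {u : E3 → E3} (hu : ContDiffOn ℝ r u U)
    (h : ∀ x ∈ U, (Δ u) x = 0 ∧ ∇ (divergence u) x = 0) : HasSpecialRepresentation r U u := by
  have h4 : (4 : WithTop ℕ∞) ≤ r := four_le_coe hr
  have hu4 : ContDiffOn ℝ 4 u U := hu.of_le h4
  have hd : DifferentiableOn ℝ (divergence u) U := fun x hx =>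
    (DifferentiableAt.fun_sum fun i _ => differentiableAt_of_contDiffOn hUo
      (contDiffOn_pd_apply (m := 3) hUo hu4 (by norm_num) i i)
      (by norm_num) hx).differentiableWithinAt
  -- Star convexity places the centre in `U` only when `U` is nonempty.
  have hpre : IsPreconnected U := by
    rcases U.eq_empty_or_nonempty with rfl | hne
    · exact isPreconnected_empty
    · exact (hU.isPathConnected (hU.mem hne)).isConnected.isPreconnected
  obtain ⟨c, hc⟩ := hUo.exists_is_const_of_fderiv_eq_zero hpre hd fun x hx => by
    rw [← toDual_gradient, (h x hx).2, map_zero]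
    rfl
  have hl : ContDiff ℝ r fun y : E3 => (c / 3) • y := contDiff_id.const_smul (c / 3)
  have hv : ContDiffOn ℝ r (fun y => u y - (c / 3) • y) U := hu.sub hl.contDiffOn
  have hlin (i k : Fin 3) : pd i (fun y : E3 => ((c / 3) • y) k) = fun _ => c / 3 * kron k i := by
    have := pd_affine ((c / 3) • ContinuousLinearMap.id ℝ E3) 0 i k
    simpa [kron, Pi.single_apply] using this
  -- The constant vector may be zero: any translation in u stays in w, being harmonic and
  -- divergence-free.
  refine ⟨c, 0, fun y => u y - (c / 3) • y, isDivOfPoissonPotential_of_laplacian_eq_zero hUo hU hr hv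
    (fun x hx => ?_) (fun x hx => ?_), fun x hx => by simp⟩
  · have h₁ (i : Fin 3) : pd i (fun y => (u y - (c / 3) • y) i) x =
        pd i (fun y => u y i) x - c / 3 * kron i i := by
      have := pd_sub (f := fun y => u y i) (g := fun y => ((c / 3) • y) i) (x := x)
        (differentiableAt_of_contDiffOn hUo (contDiffOn_apply hu4 i) (by norm_num) hx)
        (differentiableAt_of_contDiffOn hUo (contDiffOn_apply (hl.contDiffOn.of_le h4) i)
          (by norm_num) hx) i
      rw [hlin] at this
      exact this
    rw [divergence, Finset.sum_congr rfl fun i _ => h₁ i, Finset.sum_sub_distrib]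
    have h₂ := hc x hx
    rw [divergence] at h₂
    rw [h₂]
    simp [kron]
    ring
  · have hl2 : ContDiff ℝ 2 fun y : E3 => (c / 3) • y := hl.of_le (le_trans (by norm_num) h4)
    have h₁ := ContDiffAt.laplacian_sub (f₁ := u) (f₂ := fun y : E3 => (c / 3) • y) (x := x)
      ((hu4.contDiffAt (hUo.mem_nhds hx)).of_le (by norm_num)) hl2.contDiffAt
    refine h₁.trans ?_
    rw [(h x hx).1, zero_sub, neg_eq_zero]
    ext k
    rw [laplacian_coord isOpen_univ hl2.contDiffOn x trivial]
    simp only [hlin, pd_const, Finset.sum_const_zero]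
    rfl

theorem HasSpecialRepresentation.hasRepresentation {u : E3 → E3}
    (h : HasSpecialRepresentation r U u) : HasRepresentation r U u := by
  obtain ⟨c, k, w, hw, hu⟩ := h
  exact ⟨(c / 3) • ContinuousLinearMap.id ℝ E3, k, w, hw, fun x hx => by simpa using hu x hx⟩

end Potentials

end StrainGradient

/-! ### Assembly of the equivalences -/

theorem mainTheorem2 (conv : HyperstressContraction) :
    (∃ f : isotropicCouplingTensors ≃ₗ[ℝ] ℝ,
      ∀ mat ∈ rotationInvariantMaterials, ∃ hM : mat.M ∈ isotropicCouplingTensors,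
        ∃ lam mu a b : ℝ, ∀ Ω : Set E3, IsOpen Ω → ∀ u : E3 → E3, ContDiffOn ℝ 4 u Ω →
          ∀ x ∈ Ω, internalForce conv mat u x =
            mu • (Δ u) x + (lam + mu) • ∇ (divergence u) x - a • (Δ (Δ u)) x
              - b • (Δ (∇ (divergence u))) x + (2 * f ⟨mat.M, hM⟩) • (Δ (curl u)) x) ∧
    ∀ (r : ℕ∞), 4 ≤ r → ∀ Ω : Set E3, IsOpen Ω → ∀ u : E3 → E3, ContDiffOn ℝ r u Ω →
      List.TFAE [
        IsUniversal conv classSO3 Ω u,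
        IsUniversal conv rotationInvariantMaterials Ω u,
        IsClassicalIsotropicUniversal Ω u,
        ∀ x ∈ Ω, (Δ u) x = 0 ∧ ∇ (divergence u) x = 0,
        ∀ x ∈ Ω, (Δ u) x = 0 ∧ ∇ (divergence u) x = 0 ∧ (Δ (curl u)) x = 0,
        ∀ U : Set E3, IsOpen U → U ⊆ Ω → ∀ x₀ : E3, StarConvex ℝ x₀ U →
          HasSpecialRepresentation r U u,
        ∀ x ∈ Ω, ∃ U : Set E3, IsOpen U ∧ x ∈ U ∧ U ⊆ Ω ∧ HasRepresentation r U u] ∧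
      ∀ x₀ : E3, StarConvex ℝ x₀ Ω →
        List.TFAE [
          IsUniversal conv classSO3 Ω u,
          IsClassicalIsotropicUniversal Ω u,
          HasSpecialRepresentation r Ω u,
          HasRepresentation r Ω u] := by
  -- λ is recovered from λ + 2μ = `C 0 0 0 0` and μ = `C 0 1 1 0`.
  refine ⟨⟨couplingEquiv _ (couplingFactor_ne_zero conv), fun mat hmat =>
    ⟨mem_isotropicCouplingTensors hmat, mat.C 0 0 0 0 - 2 * mat.C 0 1 1 0, mat.C 0 1 1 0,
      transverseModulus mat.A conv, mat.A 0 0 0 0 0 0 - transverseModulus mat.A conv,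
      fun Ω hΩ u hu x hx => ?_⟩⟩, fun r hr Ω hΩ u hu => ?_⟩
  · rw [internalForce_formula conv hmat Ω hΩ u hu x hx, couplingEquiv_apply,
      show mat.C 0 0 0 0 - 2 * mat.C 0 1 1 0 + mat.C 0 1 1 0 = mat.C 0 0 0 0 - mat.C 0 1 1 0 by ring]
  have hu4 : ContDiffOn ℝ 4 u Ω := hu.of_le (four_le_coe hr)
  have h31 : IsClassicalIsotropicUniversal Ω u ↔ ∀ x ∈ Ω, (Δ u) x = 0 ∧ ∇ (divergence u) x = 0 :=
    isClassicalIsotropicUniversal_iff hΩ hu4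
  have h14 : IsUniversal conv classSO3 Ω u ↔ ∀ x ∈ Ω, (Δ u) x = 0 ∧ ∇ (divergence u) x = 0 :=
    ⟨laplacian_eq_zero_of_isUniversal conv hΩ hu4, fun h mat hmat =>
      isUniversal_of_laplacian_eq_zero conv hΩ hu4 h mat (classSO3_subset hmat)⟩
  refine ⟨?_, fun x₀ hstar => ?_⟩
  · tfae_have 1 ↔ 4 := h14
    tfae_have 4 → 2 := isUniversal_of_laplacian_eq_zero conv hΩ hu4
    tfae_have 2 → 1 := fun h mat hmat => h mat (classSO3_subset hmat)
    tfae_have 3 ↔ 4 := h31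
    tfae_have 4 → 5 := fun h x hx =>
      ⟨(h x hx).1, (h x hx).2, laplacian_curl_eq_zero hΩ hu4 (fun y hy => (h y hy).1) hx⟩
    tfae_have 5 → 4 := fun h x hx => ⟨(h x hx).1, (h x hx).2.1⟩
    tfae_have 4 → 6 := fun h U hU hUΩ x₀ hstar =>
      hasSpecialRepresentation_of_laplacian_eq_zero hU hstar hr (hu.mono hUΩ)
        fun x hx => h x (hUΩ hx)
    tfae_have 6 → 7 := fun h x hx => by
      -- A ball inside Ω is star-shaped about its centre, so the star-shaped statement implies the
      -- local one.
      obtain ⟨ε, hε, hs⟩ := Metric.isOpen_iff.1 hΩ x hx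
      exact ⟨Metric.ball x ε, Metric.isOpen_ball, Metric.mem_ball_self hε, hs,
        (h _ Metric.isOpen_ball hs x
          ((convex_ball x ε).starConvex (Metric.mem_ball_self hε))).hasRepresentation⟩
    tfae_have 7 → 4 := fun h x hx => by
      obtain ⟨U, hU, hxU, -, hrep⟩ := h x hx
      exact laplacian_eq_zero_of_hasRepresentation hU hr hrep x hxU
    tfae_finish
  · tfae_have 1 ↔ 2 := h14.trans h31.symm
    tfae_have 2 → 3 := fun h =>
      hasSpecialRepresentation_of_laplacian_eq_zero hΩ hstar hr hu (h31.1 h)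
    tfae_have 3 → 4 := HasSpecialRepresentation.hasRepresentation
    tfae_have 4 → 2 := fun h => h31.2 (laplacian_eq_zero_of_hasRepresentation hΩ hr h)
    tfae_finish
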